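/- Let $n\ge 1$ be an integer, $\tau_1,\dots,\tau_{n-1}\in\mathbb R$, and $$p(z)=p_{2n+1}(z)=\frac{z^{2n+1}}{2n+1}+\sum_{j=1}^{n-1}\frac{\tau_j}{2j+1}z^{2j+1},\qquad \vartheta=\frac{n\pi}{2n+1}.$$ Let $\gamma_L$ and $\gamma_R$ be locally rectifiable curves without self-intersections in the open left, respectively right, half plane, whose length inside the disk $|z|\le R$ is bounded by a power of $R$ for $R\ge 1$, going to infinity at both ends asymptotically in the following directions: $\gamma_L$ goes upwards from direction $-e^{i\vartheta}$ to direction $-e^{-i\vartheta}$, and $\gamma_R$ goes downwards from direction $e^{i\vartheta}$ to direction $e^{-i\vartheta}$ (a curve has direction $u$ at an end if $z/|z|\to u$ there). For $x,y\in\mathbb R$ put $$K(x,y)=\frac1{(2\pi i)^2}\int_{\gamma_R}d\mu\int_{\gamma_L}d\lambda\;\frac{e^{(-1)^{n+1}(p(\mu)-p(\lambda))-x\mu+y\lambda}}{\lambda-\mu}.$$ For $s\in\mathbb R$ let $\chi_L,\chi_R$ be the indicator functions of $\gamma_L,\gamma_R$, let $$f(\lambda)=\frac1{2\pi i}\begin{pmatrix}e^{\frac{(-1)^{n+1}}2p(\lambda)}\chi_R(\lambda)\\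 e^{\frac{(-1)^{n}}2p(\lambda)+s\lambda}\chi_L(\lambda)\end{pmatrix},\qquad g(\mu)=\begin{pmatrix}e^{\frac{(-1)^{n}}2p(\mu)}\chi_L(\mu)\\ e^{\frac{(-1)^{n+1}}2p(\mu)-s\mu}\chi_R(\mu)\end{pmatrix},$$ and let $$L_s(\lambda,\mu)=\frac{f^{\mathrm T}(\lambda)g(\mu)}{\lambda-\mu}\quad(\lambda\ne\mu),\qquad L_s(\lambda,\lambda)=0.$$ Let $\mathcal L_s$ be the operator $(\mathcal L_sh)(\lambda)=\int_{\gamma_L\cup\gamma_R}L_s(\lambda,\mu)h(\mu)\,d\mu$ on $L^2(\gamma_L\cup\gamma_R)$ (with respect to arc length), and $\mathcal K|_{[s,\infty)}$ the integral operator with kernel $K$ on $L^2(s,\infty)$. For an integral operator $\mathcal A$ with kernel $A$ on $L^2(X)$ define $$\det(\mathbf I-z\mathcal A)=1+\sum_{k\ge1}\frac{(-z)^k}{k!}\int_{X^k}\det[A(\xi_i,\xi_j)]_{i,j=1}^k\,d\xi_1\cdots d\xi_k ,$$ where for $\mathcal L_s$ the integrals are contour integrals. Then the double integral defining $K$ converges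 absolutely, $f^{\mathrm T}(\lambda)g(\lambda)=0$ for all $\lambda$, the operators $\mathcal L_s$ and $\mathcal K|_{[s,\infty)}$ are well defined, bounded and trace class, and for every $0<\varrho\le1$ the Fredholm series of $\det(\mathbf I-\sqrt\varrho\,\mathcal L_s)$ and $\det(\mathbf I-\varrho\,\mathcal K|_{[s,\infty)})$ converge absolutely (all their integrals and the series), and $$\det(\mathbf I-\sqrt\varrho\,\mathcal L_s)=\det\big(\mathbf I-\varrho\,\mathcal K|_{[s,\infty)}\big).$$ -/

import Mathlib

open MeasureTheory Filter Topology

noncomputable section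

namespace OddAiry

/-! ### Fredholm determinants and trace class operators -/

/-- The `j`-th integrand `det [k (x_a, x_b)]_{a,b = 1}^j` of the Fredholm series of a kernel `k`. -/
def fredholmMinor {X : Type*} (k : X → X → ℂ) (j : ℕ) (x : Fin j → X) : ℂ :=
  Matrix.det (Matrix.of fun a b : Fin j => k (x a) (x b))

/-- The `j`-th term `(-z)^j / j! * ∫_{X^j} det [k (x_a, x_b)] dm(x_1) ⋯ dm(x_j)` of the Fredholm
series. The term with `j = 0` is `1`. -/
def fredholmTerm {X : Type*} [MeasurableSpace X] (m : Measure X) (k : X → X → ℂ) (z : ℂ)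
    (j : ℕ) : ℂ :=
  (-z) ^ j / (j.factorial : ℂ) * ∫ x, fredholmMinor k j x ∂(Measure.pi fun _ : Fin j => m)

/-- All integrals in the Fredholm series converge absolutely, and so does the series. -/
def FredholmConverges {X : Type*} [MeasurableSpace X] (m : Measure X) (k : X → X → ℂ)
    (z : ℂ) : Prop :=
  (∀ j : ℕ, Integrable (fredholmMinor k j) (Measure.pi fun _ : Fin j => m)) ∧
    Summable (fredholmTerm m k z)

/-- The Fredholm determinant `det (I - z k)` of the integral operator with kernel `k` with respect
to the measure `m`, as the sum of its Fredholm series. -/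
def fredholmDet {X : Type*} [MeasurableSpace X] (m : Measure X) (k : X → X → ℂ) (z : ℂ) : ℂ :=
  ∑' j : ℕ, fredholmTerm m k z j

/-- `T` is the integral operator on `L²(m)` with kernel `k`. -/
def IsIntegralOperator {X : Type*} [MeasurableSpace X] (m : Measure X) (k : X → X → ℂ)
    (T : Lp ℂ 2 m →L[ℂ] Lp ℂ 2 m) : Prop :=
  ∀ h : Lp ℂ 2 m, ∀ᵐ x ∂m,
    Integrable (fun y => k x y * h y) m ∧ T h x = ∫ y, k x y * h y ∂m

/-- Trace class (nuclear) operators on a Hilbert space: `T = ∑ ⟨a_i, ·⟩ b_i` with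
`∑ ‖a_i‖ ‖b_i‖ < ∞`. -/
def IsTraceClass {E : Type*} [NormedAddCommGroup E] [InnerProductSpace ℂ E]
    (T : E →L[ℂ] E) : Prop :=
  ∃ a b : ℕ → E, Summable (fun i => ‖a i‖ * ‖b i‖) ∧
    ∀ x : E, HasSum (fun i => inner ℂ (a i) x • b i) (T x)

/-! ### Curves in the complex plane -/

/-- The arc length measure `|dz|` of a locally Lipschitz injective curve, as a measure on `ℂ`. -/
def arcLength (γ : ℝ → ℂ) : Measure ℂ :=
  (volume.withDensity fun t => ‖deriv γ t‖ₑ).map γ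

/-- The contour integral `∫_γ f(z) dz`. -/
def contourIntegral (γ : ℝ → ℂ) (f : ℂ → ℂ) : ℂ :=
  ∫ t : ℝ, f (γ t) * deriv γ t

/-- The unit tangent of the injective curve `γ` at a point `z` of it (and `0` off the curve), so
that `dz = unitTangent γ z |dz|` along `γ`. -/
def unitTangent (γ : ℝ → ℂ) : ℂ → ℂ :=
  (Set.range γ).indicator fun z =>
    deriv γ (Function.invFun γ z) / (‖deriv γ (Function.invFun γ z)‖ : ℂ)

/-- `γ` is a locally rectifiable curve without self-intersections (in a locally Lipschitz
parametrization) that comes from infinity in the direction `u` and goes to infinity in the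
direction `v`, and whose length inside large disks grows at most polynomially. -/
structure IsContour (γ : ℝ → ℂ) (u v : ℂ) : Prop where
  locallyLipschitz : LocallyLipschitz γ
  injective : Function.Injective γ
  norm_atBot : Tendsto (fun t => ‖γ t‖) atBot atTop
  norm_atTop : Tendsto (fun t => ‖γ t‖) atTop atTop
  dir_atBot : Tendsto (fun t => γ t / (‖γ t‖ : ℂ)) atBot (𝓝 u)
  dir_atTop : Tendsto (fun t => γ t / (‖γ t‖ : ℂ)) atTop (𝓝 v)
  length_growth : ∃ (C : ℝ) (N : ℕ), ∀ R : ℝ, 1 ≤ R →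
    arcLength γ (Metric.closedBall 0 R) ≤ ENNReal.ofReal (C * R ^ N)

/-- The direction `e^{iϑ}` with `ϑ = nπ / (2n + 1)`. -/
def asymDir (n : ℕ) : ℂ :=
  Complex.exp (((n : ℝ) / (2 * (n : ℝ) + 1) * Real.pi : ℝ) * Complex.I)

/-- A contour `γ_L`: in the open left half plane, asymptotic at both ends to the lines through `0`
with arguments `± nπ / (2n + 1)`, oriented upwards (from `-e^{iϑ} ∞` to `-e^{-iϑ} ∞`). -/
def IsLeftContour (n : ℕ) (γ : ℝ → ℂ) : Prop :=
  IsContour γ (-asymDir n) (-(asymDir n)⁻¹) ∧ ∀ t, (γ t).re < 0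

/-- A contour `γ_R`: in the open right half plane, asymptotic at both ends to the lines through `0`
with arguments `± nπ / (2n + 1)`, oriented downwards (from `e^{iϑ} ∞` to `e^{-iϑ} ∞`). -/
def IsRightContour (n : ℕ) (γ : ℝ → ℂ) : Prop :=
  IsContour γ (asymDir n) (asymDir n)⁻¹ ∧ ∀ t, 0 < (γ t).re

/-! ### The two kernels -/

/-- The odd polynomial `p_{2n+1}(z) = z^{2n+1}/(2n+1) + ∑_{j=1}^{n-1} τ_j z^{2j+1}/(2j+1)`; only
`τ_1, …, τ_{n-1}` matter. -/
def oddPoly (n : ℕ) (τ : ℕ → ℝ) (z : ℂ) : ℂ :=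
  z ^ (2 * n + 1) / (2 * (n : ℂ) + 1) +
    ∑ j ∈ Finset.Ico 1 n, (τ j : ℂ) / (2 * (j : ℂ) + 1) * z ^ (2 * j + 1)

/-- The integrand `e^{(-1)^{n+1} (p(μ) - p(l)) - x μ + y l} / (l - μ)` of the kernel `K(x, y)`. -/
def airyIntegrand (n : ℕ) (τ : ℕ → ℝ) (x y : ℝ) (μ l : ℂ) : ℂ :=
  Complex.exp ((-1) ^ (n + 1) * (oddPoly n τ μ - oddPoly n τ l) - x * μ + y * l) / (l - μ)

/-- The kernel `K(x, y) = (2πi)^{-2} ∫_{γ_R} dμ ∫_{γ_L} dl (airyIntegrand)`. -/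
def airyKernel (n : ℕ) (τ : ℕ → ℝ) (γL γR : ℝ → ℂ) (x y : ℝ) : ℂ :=
  1 / (2 * Real.pi * Complex.I) ^ 2 *
    contourIntegral γR fun μ => contourIntegral γL fun l => airyIntegrand n τ x y μ l

/-- The indicator function of (the trace of) a curve. -/
def curveInd (γ : ℝ → ℂ) : ℂ → ℂ := (Set.range γ).indicator fun _ => 1

/-- The column vector `f(z)`. -/
def vecF (n : ℕ) (τ : ℕ → ℝ) (γL γR : ℝ → ℂ) (s : ℝ) (z : ℂ) : Fin 2 → ℂ :=
  (1 / (2 * Real.pi * Complex.I)) •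
    ![Complex.exp ((-1) ^ (n + 1) / 2 * oddPoly n τ z) * curveInd γR z,
      Complex.exp ((-1) ^ n / 2 * oddPoly n τ z + s * z) * curveInd γL z]

/-- The column vector `g(z)`. -/
def vecG (n : ℕ) (τ : ℕ → ℝ) (γL γR : ℝ → ℂ) (s : ℝ) (z : ℂ) : Fin 2 → ℂ :=
  ![Complex.exp ((-1) ^ n / 2 * oddPoly n τ z) * curveInd γL z,
    Complex.exp ((-1) ^ (n + 1) / 2 * oddPoly n τ z - s * z) * curveInd γR z]

/-- The integrable kernel `L_s(l, μ) = f(l)ᵀ g(μ) / (l - μ)`; it vanishes for `l = μ`. -/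
def kernelL (n : ℕ) (τ : ℕ → ℝ) (γL γR : ℝ → ℂ) (s : ℝ) (l μ : ℂ) : ℂ :=
  (vecF n τ γL γR s l ⬝ᵥ vecG n τ γL γR s μ) / (l - μ)

/-- The kernel of `h ↦ ∫_{γ_L ∪ γ_R} L_s(·, μ) h(μ) dμ` with respect to the arc length measure
`|dμ|` of `γ_L ∪ γ_R`. -/
def kernelLArc (n : ℕ) (τ : ℕ → ℝ) (γL γR : ℝ → ℂ) (s : ℝ) (l μ : ℂ) : ℂ :=
  kernelL n τ γL γR s l μ * (unitTangent γL μ + unitTangent γR μ)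

end OddAiry

end

open OddAiry MeasureTheory

/-! The weights in `f` and `g` live on disjoint curves, so in the splitting L²(γR) ⊕ L²(γL) the
operator `L_s` is off-diagonal: a block A from γL to γR and a block B from γR to γL. Formally det(I
- zA - zB) = det(I - z²AB), which is where √ϱ turns into ϱ. Both blocks are Cauchy kernels 1/(x - y)
times weights. Since Re(x - y) > 0 for x on γR and y on γL, the factor e^{-s(x-y)}/(x - y) in B is
the Laplace integral of e^{-t(x-y)} over [s, ∞), so that B = CD factors through L²(s, ∞)
(`kernelLR_eq`). Then det(I - z²ACD) = det(I - z²DAC), and DAC is exactly the kernel K once each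
e^{±p} is split into two equal halves (`airyKernel_eq`).

The determinant identity is proved term by term in the Fredholm series. The odd terms on the left
vanish, and the term of index 2m equals the term of index m on the right at z². The left side
reduces to an integral of det A · det B by a block determinant count (`fredholmTerm_offDiag_even`),
the right side by Andréief's identity (`integral_minor_comp`).

All convergence rests on one decay estimate (`exists_decay`). The asymptotic directions satisfy
u^{2n+1} = (-1)^n, so (-1)^{n+1}p behaves like -|z|^{2n+1}/(2n+1) on γR; γL follows by z ↦ -z,
because p is odd. The weights are thus bounded by a multiple of e^{-|z|}, which is integrable by
polynomial growth of length, and the curves stay at positive distance from the imaginary axis. The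
kernels are then dominated by products F(x)G(y), and Hadamard's inequality makes the Fredholm series
converge.

For the trace class property, the Cayley transform q(z) = (z - 1)/(z + 1) turns 1/(x + y) into a
geometric series in q(x)q(y), that is, a sum of rank one kernels with square summable factors
(`hasSum_cauchyFun_mul`, `exists_traceClass_of_hasSum`). -/

noncomputable section

namespace OddAiry

/-! ### Hadamard's inequality, convergence of Fredholm series, Andréief's identity. -/

section Fredholm

variable {X Y Z : Type*} [MeasurableSpace X] [MeasurableSpace Y] [MeasurableSpace Z]

open scoped ComplexOrder in
/-- Hadamard's bound for determinants of matrices with entries in the unit disk. -/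
theorem norm_det_sq_le {k : ℕ} (M : Matrix (Fin k) (Fin k) ℂ) (hM : ∀ a b, ‖M a b‖ ≤ 1) :
    ‖M.det‖ ^ 2 ≤ (k : ℝ) ^ k := by
  rcases Nat.eq_zero_or_pos k with rfl | hk
  · simp
  -- AM-GM for the eigenvalues of `M * Mᴴ`: their product is |det M|², their sum is ∑ |M a b|² ≤ k².
  have hP := Matrix.posSemidef_self_mul_conjTranspose M
  have hdet : ‖M.det‖ ^ 2 = ∏ i, hP.isHermitian.eigenvalues i := by
    have h := hP.isHermitian.det_eq_prod_eigenvalues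
    rw [Matrix.det_mul, Matrix.det_conjTranspose] at h
    have h2 : ((‖M.det‖ ^ 2 : ℝ) : ℂ) = ((∏ i, hP.isHermitian.eigenvalues i : ℝ) : ℂ) := by
      push_cast
      rw [← Complex.mul_conj']
      simpa using h
    exact_mod_cast h2
  have htr : ∑ i, hP.isHermitian.eigenvalues i ≤ (k : ℝ) * k := by
    have h := hP.isHermitian.trace_eq_sum_eigenvalues
    have h2 : ((∑ a, ∑ b, ‖M a b‖ ^ 2 : ℝ) : ℂ)
        = ((∑ i, hP.isHermitian.eigenvalues i : ℝ) : ℂ) := by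
      push_cast
      rw [← show _ = ∑ i, (hP.isHermitian.eigenvalues i : ℂ) from h]
      simp only [Matrix.trace, Matrix.diag_apply, Matrix.mul_apply, Matrix.conjTranspose_apply]
      refine Finset.sum_congr rfl fun a _ => Finset.sum_congr rfl fun b _ => ?_
      rw [← Complex.mul_conj']
      rfl
    have h3 : ∑ i, hP.isHermitian.eigenvalues i = ∑ a, ∑ b, ‖M a b‖ ^ 2 := by exact_mod_cast h2.symm
    rw [h3]
    calc ∑ a, ∑ b, ‖M a b‖ ^ 2 ≤ ∑ _a : Fin k, ∑ _b : Fin k, (1 : ℝ) := by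
          gcongr with a _ b _
          exact pow_le_one₀ (norm_nonneg _) (hM a b)
      _ = k * k := by simp
  have hk' : (0 : ℝ) < k := by exact_mod_cast hk
  have hAG := Real.geom_mean_le_arith_mean_weighted Finset.univ (fun _ : Fin k => (k : ℝ)⁻¹)
    hP.isHermitian.eigenvalues (fun _ _ => by positivity) (by simp [hk'.ne'])
    (fun i _ => hP.eigenvalues_nonneg i)
  rw [← Finset.mul_sum, Real.finsetProd_rpow _ _ fun i _ => hP.eigenvalues_nonneg i] at hAG
  have h4 : (∏ i, hP.isHermitian.eigenvalues i) ^ (k : ℝ)⁻¹ ≤ k := by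
    refine hAG.trans ?_
    rw [inv_mul_le_iff₀ hk']
    exact htr
  have h0 : 0 ≤ ∏ i, hP.isHermitian.eigenvalues i :=
    Finset.prod_nonneg fun i _ => hP.eigenvalues_nonneg i
  rw [hdet]
  calc ∏ i, hP.isHermitian.eigenvalues i
      = ((∏ i, hP.isHermitian.eigenvalues i) ^ (k : ℝ)⁻¹) ^ k :=
        (Real.rpow_inv_natCast_pow h0 hk.ne').symm
    _ ≤ (k : ℝ) ^ k := by gcongr

/-- Pull `F` out of the rows and `G` out of the columns; what remains has entries in the unit disk.
Where `F a * G b = 0` the entry is zero anyway, so the division is harmless. -/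
theorem norm_det_le {k : ℕ} (M : Matrix (Fin k) (Fin k) ℂ) (F G : Fin k → ℝ) (hF : ∀ a, 0 ≤ F a)
    (hG : ∀ a, 0 ≤ G a) (hM : ∀ a b, ‖M a b‖ ≤ F a * G b) :
    ‖M.det‖ ≤ √((k : ℝ) ^ k) * ((∏ a, F a) * ∏ a, G a) := by
  set N : Matrix (Fin k) (Fin k) ℂ := Matrix.of fun a b => M a b / (F a * G b) with hN
  have hMN : M = Matrix.of fun a b => (F a : ℂ) * (Matrix.of fun a b => (G b : ℂ) * N a b) a b := by
    ext a b
    by_cases h : (F a : ℂ) * G b = 0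
    · have h0 : F a * G b = 0 := by exact_mod_cast h
      have hz : M a b = 0 := norm_le_zero_iff.1 (h0 ▸ hM a b)
      simp [hN, hz]
    · simp only [hN, Matrix.of_apply]
      rw [← mul_assoc, mul_div_cancel₀ _ h]
  have hNb : ∀ a b, ‖N a b‖ ≤ 1 := fun a b => by
    simp only [hN, Matrix.of_apply, norm_div, norm_mul, Complex.norm_real, Real.norm_eq_abs,
      abs_of_nonneg (hF a), abs_of_nonneg (hG b)]
    exact div_le_one_of_le₀ (hM a b) (mul_nonneg (hF a) (hG b))
  have hd : M.det = (∏ a, (F a : ℂ)) * ((∏ a, (G a : ℂ)) * N.det) := by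
    conv_lhs => rw [hMN]
    rw [Matrix.det_mul_column, Matrix.det_mul_row]
  have hdN : ‖N.det‖ ≤ √((k : ℝ) ^ k) := Real.le_sqrt_of_sq_le (norm_det_sq_le N hNb)
  rw [hd, norm_mul, norm_mul, norm_prod, norm_prod]
  simp only [Complex.norm_real, Real.norm_eq_abs, abs_of_nonneg (hF _), abs_of_nonneg (hG _)]
  have hF' : 0 ≤ ∏ a, F a := Finset.prod_nonneg fun a _ => hF a
  have hG' : 0 ≤ ∏ a, G a := Finset.prod_nonneg fun a _ => hG a
  calc (∏ a, F a) * ((∏ a, G a) * ‖N.det‖) ≤ (∏ a, F a) * ((∏ a, G a) * √((k : ℝ) ^ k)) := by gcongr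
    _ = _ := by ring

theorem measurable_matrix_det {k : ℕ} {M : X → Matrix (Fin k) (Fin k) ℂ}
    (hM : ∀ a b, Measurable fun x => M x a b) : Measurable fun x => (M x).det := by
  simp only [Matrix.det_apply']
  exact Finset.measurable_fun_sum _ fun σ _ =>
    measurable_const.mul (Finset.measurable_fun_prod _ fun i _ => hM _ _)

theorem measurable_fredholmMinor {k : X → X → ℂ} (hk : Measurable (Function.uncurry k)) (j : ℕ) :
    Measurable (fredholmMinor k j) :=
  measurable_matrix_det fun a b => 
    hk.comp (g := Function.uncurry k) (f := fun x : Fin j → X => (x a, x b))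
      ((measurable_pi_apply a).prodMk (measurable_pi_apply b))

theorem ae_pi_forall_mem {m : Measure X} [SigmaFinite m] {S : Set X} (hS : ∀ᵐ x ∂m, x ∈ S)
    (j : ℕ) : ∀ᵐ x ∂(Measure.pi fun _ : Fin j => m), ∀ a, x a ∈ S :=
  ae_all_iff.2 fun a => (Measure.tendsto_eval_ae_ae (i := a)).eventually hS

theorem fredholmMinor_bound {m : Measure X} [SigmaFinite m] {k : X → X → ℂ} {S : Set X}
    (hS : ∀ᵐ x ∂m, x ∈ S) {F G : X → ℝ} (hF : ∀ x, 0 ≤ F x) (hG : ∀ x, 0 ≤ G x)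
    (hb : ∀ x ∈ S, ∀ y ∈ S, ‖k x y‖ ≤ F x * G y) (j : ℕ) :
    ∀ᵐ x ∂(Measure.pi fun _ : Fin j => m),
      ‖fredholmMinor k j x‖ ≤ √((j : ℝ) ^ j) * ∏ a, (F (x a) * G (x a)) := by
  filter_upwards [ae_pi_forall_mem hS j] with x hx
  rw [Finset.prod_mul_distrib]
  exact norm_det_le _ _ _ (fun a => hF _) (fun a => hG _) fun a b => hb _ (hx a) _ (hx b)

theorem pow_self_le_exp_mul_factorial (j : ℕ) : (j : ℝ) ^ j ≤ Real.exp 1 ^ j * j.factorial := by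
  have h := Real.pow_div_factorial_le_exp (j : ℝ) (by positivity) j
  rw [div_le_iff₀ (by positivity)] at h
  rwa [← Real.exp_nat_mul, mul_one]

/-- By j^j ≤ e^j j!, the square of 2^j times the term is at most (4u²e)^j / j!. Writing the term as
this enlarged quantity times 2^{-j} and using ab ≤ a² + b² leaves an exponential and a geometric
series. -/
theorem summable_pow_mul_sqrt_div_factorial {u : ℝ} (hu : 0 ≤ u) :
    Summable fun j : ℕ => u ^ j * √((j : ℝ) ^ j) / j.factorial := by
  have h1 := Real.summable_pow_div_factorial (4 * u ^ 2 * Real.exp 1)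
  have h2 := summable_geometric_of_lt_one (r := (1 / 4 : ℝ)) (by norm_num) (by norm_num)
  refine Summable.of_nonneg_of_le (fun j => by positivity) (fun j => ?_) (h1.add h2)
  have hf : (0 : ℝ) < j.factorial := by positivity
  have hx : (2 ^ j * u ^ j * √((j : ℝ) ^ j) / j.factorial) ^ 2
      ≤ (4 * u ^ 2 * Real.exp 1) ^ j / j.factorial := by
    rw [div_pow, mul_pow _ (√_), Real.sq_sqrt (by positivity), div_le_div_iff₀ (by positivity) hf]
    have := pow_self_le_exp_mul_factorial j
    calc (2 ^ j * u ^ j) ^ 2 * (j : ℝ) ^ j * j.factorial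
        ≤ (2 ^ j * u ^ j) ^ 2 * (Real.exp 1 ^ j * j.factorial) * j.factorial := by gcongr
      _ = (2 ^ 2) ^ j * u ^ (2 * j) * Real.exp 1 ^ j * (j.factorial : ℝ) ^ 2 := by
        rw [← pow_mul, mul_comm 2 j, pow_mul, pow_mul]; ring
      _ = (4 * u ^ 2 * Real.exp 1) ^ j * (j.factorial : ℝ) ^ 2 := by
        rw [mul_pow, mul_pow, pow_mul]; norm_num
  have hy : ((1 / 2 : ℝ) ^ j) ^ 2 = (1 / 4) ^ j := by
    rw [← pow_mul, mul_comm, pow_mul]; norm_num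
  have hxy : u ^ j * √((j : ℝ) ^ j) / j.factorial
      = (2 ^ j * u ^ j * √((j : ℝ) ^ j) / j.factorial) * (1 / 2 : ℝ) ^ j := by
    have : (2 : ℝ) ^ j * (1 / 2) ^ j = 1 := by rw [← mul_pow]; norm_num
    calc _ = u ^ j * √((j : ℝ) ^ j) / j.factorial * ((2 : ℝ) ^ j * (1 / 2) ^ j) := by
          rw [this, mul_one]
      _ = _ := by ring
  rw [hxy]
  nlinarith [sq_nonneg ((2 ^ j * u ^ j * √((j : ℝ) ^ j) / j.factorial) - (1 / 2 : ℝ) ^ j),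
    sq_nonneg ((2 ^ j * u ^ j * √((j : ℝ) ^ j) / j.factorial)), sq_nonneg ((1 / 2 : ℝ) ^ j)]

theorem integrable_fredholmMinor {m : Measure X} [SigmaFinite m] {k : X → X → ℂ}
    (hk : Measurable (Function.uncurry k)) {S : Set X} (hS : ∀ᵐ x ∂m, x ∈ S) {F G : X → ℝ}
    (hF : ∀ x, 0 ≤ F x) (hG : ∀ x, 0 ≤ G x) (hFG : Integrable (fun x => F x * G x) m)
    (hb : ∀ x ∈ S, ∀ y ∈ S, ‖k x y‖ ≤ F x * G y) (j : ℕ) :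
    Integrable (fredholmMinor k j) (Measure.pi fun _ : Fin j => m) :=
  ((Integrable.fintype_prod fun _ => hFG).const_mul _).mono'
    (measurable_fredholmMinor hk j).aestronglyMeasurable (fredholmMinor_bound hS hF hG hb j)

theorem fredholmConverges_of_bound {m : Measure X} [SigmaFinite m] {k : X → X → ℂ}
    (hk : Measurable (Function.uncurry k)) {S : Set X} (hS : ∀ᵐ x ∂m, x ∈ S) {F G : X → ℝ}
    (hF : ∀ x, 0 ≤ F x) (hG : ∀ x, 0 ≤ G x) (hFG : Integrable (fun x => F x * G x) m)
    (hb : ∀ x ∈ S, ∀ y ∈ S, ‖k x y‖ ≤ F x * G y) (z : ℂ) : FredholmConverges m k z := by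
  refine ⟨integrable_fredholmMinor hk hS hF hG hFG hb, ?_⟩
  set I := ∫ x, F x * G x ∂m with hI
  have hI0 : 0 ≤ I := integral_nonneg fun x => mul_nonneg (hF x) (hG x)
  refine Summable.of_norm_bounded
    (summable_pow_mul_sqrt_div_factorial (mul_nonneg (norm_nonneg z) hI0)) fun j => ?_
  have h1 : ‖∫ x, fredholmMinor k j x ∂(Measure.pi fun _ : Fin j => m)‖ ≤ √((j : ℝ) ^ j) * I ^ j := by
    refine (norm_integral_le_of_norm_le ((Integrable.fintype_prod fun _ => hFG).const_mul _)
      (fredholmMinor_bound hS hF hG hb j)).trans_eq ?_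
    rw [integral_const_mul]
    congr 1
    have := integral_fintype_prod_eq_pow (ι := Fin j) (μ := m) (fun x => F x * G x)
    simpa using this
  rw [fredholmTerm, norm_mul, norm_div, norm_pow, norm_neg, Complex.norm_natCast]
  calc ‖z‖ ^ j / j.factorial * ‖∫ x, fredholmMinor k j x ∂(Measure.pi fun _ : Fin j => m)‖
      ≤ ‖z‖ ^ j / j.factorial * (√((j : ℝ) ^ j) * I ^ j) := by gcongr
    _ = (‖z‖ * I) ^ j * √((j : ℝ) ^ j) / j.factorial := by rw [mul_pow]; ring

/-- Andréief's identity. -/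
theorem integral_det_mul_det (ν : Measure Y) [SigmaFinite ν] {k : ℕ} (A B : Fin k → Y → ℂ)
    (h : ∀ a b, Integrable (fun y => A a y * B b y) ν) :
    ∫ y, (Matrix.of fun a b => A a (y b)).det * (Matrix.of fun a b => B b (y a)).det
        ∂(Measure.pi fun _ : Fin k => ν) =
      k.factorial * (Matrix.of fun a b => ∫ y, A a y * B b y ∂ν).det := by
  set M : Matrix (Fin k) (Fin k) ℂ := Matrix.of fun a b => ∫ y, A a y * B b y ∂ν with hM
  have hexp : ∀ y : Fin k → Y,
      (Matrix.of fun a b => A a (y b)).det * (Matrix.of fun a b => B b (y a)).det =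
        ∑ σ : Equiv.Perm (Fin k), ∑ π : Equiv.Perm (Fin k),
          ((Equiv.Perm.sign σ : ℤ) : ℂ) * ((Equiv.Perm.sign π : ℤ) : ℂ) *
            ∏ i, (A (σ i) (y i) * B (π i) (y i)) := fun y => by
    rw [← Matrix.det_transpose (Matrix.of fun a b => B b (y a)), Matrix.det_apply',
      Matrix.det_apply', Finset.sum_mul_sum]
    refine Finset.sum_congr rfl fun σ _ => Finset.sum_congr rfl fun π _ => ?_
    rw [Finset.prod_mul_distrib]
    simp only [Matrix.of_apply, Matrix.transpose_apply]
    ring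
  have hint : ∀ σ π : Equiv.Perm (Fin k),
      Integrable (fun y : Fin k → Y => ((Equiv.Perm.sign σ : ℤ) : ℂ) *
        ((Equiv.Perm.sign π : ℤ) : ℂ) * ∏ i, (A (σ i) (y i) * B (π i) (y i)))
        (Measure.pi fun _ : Fin k => ν) := fun σ π =>
    (Integrable.fintype_prod (f := fun i y => A (σ i) y * B (π i) y) fun i => h _ _).const_mul _
  simp_rw [hexp]
  rw [integral_finsetSum _ fun σ _ => integrable_finsetSum _ fun π _ => hint σ π]
  -- For fixed σ the sum over π is det M with rows permuted by σ, and the sign of σ cancels; the k!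
  -- choices of σ give the factorial.
  have hσ : ∀ σ : Equiv.Perm (Fin k), ∫ y, ∑ π : Equiv.Perm (Fin k),
      ((Equiv.Perm.sign σ : ℤ) : ℂ) * ((Equiv.Perm.sign π : ℤ) : ℂ) *
        ∏ i, (A (σ i) (y i) * B (π i) (y i)) ∂(Measure.pi fun _ : Fin k => ν) = M.det := fun σ => by
    rw [integral_finsetSum _ fun π _ => hint σ π]
    have h1 : M.det = ((Equiv.Perm.sign σ : ℤ) : ℂ) * (M.submatrix σ id).transpose.det := by
      rw [Matrix.det_transpose, Matrix.det_permute, ← mul_assoc, ← Int.cast_mul,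
        Int.units_coe_mul_self, Int.cast_one, one_mul]
    rw [h1, Matrix.det_apply', Finset.mul_sum]
    refine Finset.sum_congr rfl fun π _ => ?_
    rw [integral_const_mul, integral_fintype_prod_eq_prod (fun i y => A (σ i) y * B (π i) y),
      mul_assoc]
    simp [hM]
  rw [Finset.sum_congr rfl fun σ _ => hσ σ, Finset.sum_const, Finset.card_univ, Fintype.card_perm,
    Fintype.card_fin, nsmul_eq_mul]

end Fredholm

/-! ### Fredholm series of off-diagonal kernels. -/

section OffDiagonal

variable {Z : Type*} [MeasurableSpace Z]

/-- The sign is that of the block swap. Multiplying the swap by a unipotent matrix creates an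
identity block in the corner, after which the Schur complement gives det(-1) = (-1)^m. -/
theorem det_fromBlocks_zero_diag {m : ℕ} (A B : Matrix (Fin m) (Fin m) ℂ) :
    (Matrix.fromBlocks 0 A B 0).det = (-1) ^ m * (A.det * B.det) := by
  have h : Matrix.fromBlocks 0 A B 0 =
      Matrix.fromBlocks A 0 0 B * Matrix.fromBlocks (0 : Matrix (Fin m) (Fin m) ℂ)
        (1 : Matrix (Fin m) (Fin m) ℂ) (1 : Matrix (Fin m) (Fin m) ℂ) 0 := by
    simp [Matrix.fromBlocks_multiply]
  have h2 : (Matrix.fromBlocks (0 : Matrix (Fin m) (Fin m) ℂ) (1 : Matrix (Fin m) (Fin m) ℂ)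
      (1 : Matrix (Fin m) (Fin m) ℂ) (0 : Matrix (Fin m) (Fin m) ℂ)).det = (-1) ^ m := by
    have h3 : Matrix.fromBlocks (1 : Matrix (Fin m) (Fin m) ℂ) 1 0
        (1 : Matrix (Fin m) (Fin m) ℂ) * Matrix.fromBlocks (0 : Matrix (Fin m) (Fin m) ℂ)
        (1 : Matrix (Fin m) (Fin m) ℂ) (1 : Matrix (Fin m) (Fin m) ℂ) 0
        = Matrix.fromBlocks (1 : Matrix (Fin m) (Fin m) ℂ) 1 1 0 := by
      simp [Matrix.fromBlocks_multiply]
    have h4 := congrArg Matrix.det h3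
    rw [Matrix.det_mul, Matrix.det_fromBlocks_zero₂₁, Matrix.det_fromBlocks_one₁₁] at h4
    simpa [Matrix.det_neg] using h4
  rw [h, Matrix.det_mul, h2, Matrix.det_fromBlocks_zero₂₁]
  ring

/-- A nonzero Leibniz term needs a permutation that exchanges `T` with its complement, which forces
both to have the same size. -/
theorem det_eq_zero_of_bipartite {j : ℕ} (M : Matrix (Fin j) (Fin j) ℂ) (T : Finset (Fin j))
    (hT : 2 * T.card ≠ j) (hM : ∀ a b, (a ∈ T ↔ b ∈ T) → M a b = 0) : M.det = 0 := by
  rw [Matrix.det_apply']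
  refine Finset.sum_eq_zero fun σ _ => ?_
  suffices h : ∃ i, (σ i ∈ T ↔ i ∈ T) by
    obtain ⟨i, hi⟩ := h
    rw [Finset.prod_eq_zero (f := fun i => M (σ i) i) (Finset.mem_univ i) (hM _ _ hi), mul_zero]
  by_contra! h
  refine hT ?_
  have hmap : T.map σ.toEmbedding = Tᶜ := by
    ext i
    have := h (σ.symm i)
    simp only [Finset.mem_map_equiv, Finset.mem_compl]
    rw [Equiv.apply_symm_apply] at this
    tauto
  have hc := congrArg Finset.card hmap
  rw [Finset.card_map, Finset.card_compl, Fintype.card_fin] at hc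
  have := T.card_le_univ
  rw [Fintype.card_fin] at this
  omega

/-- The integral of a function on `Z^j` with respect to the power of a sum of two measures with
disjoint supports splits into a sum over the subsets of the coordinates. -/
theorem integral_pi_add {μ ν : Measure Z} [SigmaFinite μ] [SigmaFinite ν] {S : Set Z}
    (hS : MeasurableSet S) (hμ : ∀ᵐ z ∂μ, z ∈ S) (hν : ∀ᵐ z ∂ν, z ∉ S) {j : ℕ}
    (F : (Fin j → Z) → ℂ) (hF : Integrable F (Measure.pi fun _ : Fin j => μ + ν)) :
    ∫ x, F x ∂(Measure.pi fun _ : Fin j => μ + ν) =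
      ∑ T : Finset (Fin j), ∫ x, F x ∂(Measure.pi fun a => if a ∈ T then μ else ν) := by
  -- The boxes sort points by which coordinates lie in `S`; restricting to a box replaces each
  -- factor `μ + ν` by `μ` or `ν`.
  set box : Finset (Fin j) → Set (Fin j → Z) :=
    fun T => Set.univ.pi fun a => if a ∈ T then S else Sᶜ with hbox
  have hmem : ∀ T x, x ∈ box T ↔ ∀ a, (x a ∈ S ↔ a ∈ T) := fun T x => by
    simp only [hbox, Set.mem_univ_pi]
    refine forall_congr' fun a => ?_
    by_cases ha : a ∈ T <;> simp [ha]
  have hmeas : ∀ T, MeasurableSet (box T) := fun T =>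
    MeasurableSet.univ_pi fun a => by
      by_cases ha : a ∈ T
      · simpa [ha] using hS
      · simpa [ha] using hS.compl
  have hdisj : Pairwise (Function.onFun Disjoint box) := fun T U hTU => by
    refine Set.disjoint_left.2 fun x hx hy => hTU ?_
    ext a
    rw [← (hmem T x).1 hx a, (hmem U x).1 hy a]
  have hcover : ⋃ T, box T = Set.univ := by
    classical
    refine Set.eq_univ_of_forall fun x => Set.mem_iUnion.2 ⟨Finset.univ.filter fun a => x a ∈ S, ?_⟩
    rw [hmem]
    simp
  have hr1 : (μ + ν).restrict S = μ := by
    rw [Measure.restrict_add, Measure.restrict_eq_self_of_ae_mem hμ,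
      Measure.restrict_eq_zero.2 (by simpa [ae_iff] using hν), add_zero]
  have hr2 : (μ + ν).restrict Sᶜ = ν := by
    rw [Measure.restrict_add, Measure.restrict_eq_self_of_ae_mem (s := Sᶜ) hν,
      show μ.restrict Sᶜ = 0 from Measure.restrict_eq_zero.2 (ae_iff.1 hμ), zero_add]
  calc ∫ x, F x ∂(Measure.pi fun _ : Fin j => μ + ν)
      = ∫ x in ⋃ T, box T, F x ∂(Measure.pi fun _ : Fin j => μ + ν) := by
        rw [hcover, Measure.restrict_univ]
    _ = ∑ T, ∫ x in box T, F x ∂(Measure.pi fun _ : Fin j => μ + ν) :=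
        integral_iUnion_fintype hmeas hdisj fun T => hF.integrableOn
    _ = _ := by
        refine Finset.sum_congr rfl fun T _ => ?_
        simp only [hbox]
        rw [Measure.restrict_pi_pi]
        congr 2
        funext a
        by_cases ha : a ∈ T <;> simp [ha, hr1, hr2]

variable {μ ν : Measure Z} [SigmaFinite μ] [SigmaFinite ν] {S : Set Z}

theorem ae_pi_ite (hμ : ∀ᵐ z ∂μ, z ∈ S) (hν : ∀ᵐ z ∂ν, z ∉ S) {j : ℕ} (T : Finset (Fin j)) :
    ∀ᵐ x ∂(Measure.pi fun a : Fin j => if a ∈ T then μ else ν), ∀ a, (x a ∈ S ↔ a ∈ T) := by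
  have : ∀ a, SigmaFinite (if a ∈ T then μ else ν) := fun a => by split_ifs <;> infer_instance
  refine ae_all_iff.2 fun a => ?_
  refine (Measure.tendsto_eval_ae_ae (i := a)).eventually (p := fun z => z ∈ S ↔ a ∈ T) ?_
  by_cases ha : a ∈ T
  · simpa [ha] using hμ
  · simpa [ha] using hν

theorem integral_minor_box_eq_zero (hμ : ∀ᵐ z ∂μ, z ∈ S) (hν : ∀ᵐ z ∂ν, z ∉ S) {p q : Z → Z → ℂ}
    (hp : ∀ x y, ¬(x ∈ S ∧ y ∉ S) → p x y = 0) (hq : ∀ x y, ¬(x ∉ S ∧ y ∈ S) → q x y = 0)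
    {j : ℕ} (T : Finset (Fin j)) (hT : 2 * T.card ≠ j) :
    ∫ x, fredholmMinor (fun x y => p x y + q x y) j x
      ∂(Measure.pi fun a => if a ∈ T then μ else ν) = 0 := by
  refine integral_eq_zero_of_ae ?_
  filter_upwards [ae_pi_ite hμ hν T] with x hx
  refine det_eq_zero_of_bipartite _ T hT fun a b hab => ?_
  simp only [Matrix.of_apply]
  rw [← hx a, ← hx b] at hab
  rw [hp _ _ (by tauto), hq _ _ (by tauto), add_zero]

/-- Listing the coordinates in `T` before the others gives the matrix zero diagonal blocks almost
everywhere, with `p` in the upper right and `q` in the lower left block. -/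
theorem integral_minor_box (hμ : ∀ᵐ z ∂μ, z ∈ S) (hν : ∀ᵐ z ∂ν, z ∉ S) {p q : Z → Z → ℂ}
    (hp : ∀ x y, ¬(x ∈ S ∧ y ∉ S) → p x y = 0) (hq : ∀ x y, ¬(x ∉ S ∧ y ∈ S) → q x y = 0)
    {m : ℕ} (T : Finset (Fin (2 * m))) (hT : T.card = m) :
    ∫ x, fredholmMinor (fun x y => p x y + q x y) (2 * m) x
      ∂(Measure.pi fun a => if a ∈ T then μ else ν) =
    (-1) ^ m * ∫ w : (Fin m → Z) × (Fin m → Z), (Matrix.of fun a b => p (w.1 a) (w.2 b)).det *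
      (Matrix.of fun a b => q (w.2 a) (w.1 b)).det
      ∂((Measure.pi fun _ : Fin m => μ).prod (Measure.pi fun _ : Fin m => ν)) := by
  have hsf : ∀ a, SigmaFinite (if a ∈ T then μ else ν) := fun a => by split_ifs <;> infer_instance
  have hc1 : Fintype.card {a // a ∈ T} = m := by simpa using hT
  have hc2 : Fintype.card {a // a ∉ T} = m := by
    rw [Fintype.card_subtype_compl, Fintype.card_fin, hc1]; omega
  let e : Fin m ⊕ Fin m ≃ Fin (2 * m) :=
    ((Fintype.equivFinOfCardEq hc1).symm.sumCongr (Fintype.equivFinOfCardEq hc2).symm).trans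
      (Equiv.sumCompl fun a => a ∈ T)
  have he1 : ∀ i, e (Sum.inl i) ∈ T := fun i => ((Fintype.equivFinOfCardEq hc1).symm i).2
  have he2 : ∀ i, e (Sum.inr i) ∉ T := fun i => ((Fintype.equivFinOfCardEq hc2).symm i).2
  have h1 := measurePreserving_piCongrLeft (fun a => if a ∈ T then μ else ν) e
  have hsf' : ∀ a, SigmaFinite (if e a ∈ T then μ else ν) := fun a => hsf _
  have h2 := measurePreserving_sumPiEquivProdPi (fun a => if e a ∈ T then μ else ν)
  simp only [he1, he2, if_true, if_false] at h2
  rw [← h1.integral_comp', ← h2.symm.integral_comp', ← integral_const_mul]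
  have hμ' := ae_pi_forall_mem hμ m
  have hν' := ae_pi_forall_mem (S := Sᶜ) hν m
  refine integral_congr_ae ?_
  filter_upwards [Measure.quasiMeasurePreserving_fst.ae hμ',
    Measure.quasiMeasurePreserving_snd.ae hν'] with w hw1 hw2
  rw [← det_fromBlocks_zero_diag, fredholmMinor, ← Matrix.det_submatrix_equiv_self e]
  congr 1
  have hx : ∀ i, MeasurableEquiv.piCongrLeft (fun _ => Z) e
      ((MeasurableEquiv.sumPiEquivProdPi fun _ => Z).symm w) (e i) = Sum.elim w.1 w.2 i := fun i => by
    rw [MeasurableEquiv.coe_piCongrLeft, Equiv.piCongrLeft_apply_apply]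
    cases i <;> rfl
  ext a b
  simp only [Matrix.submatrix_apply, Matrix.of_apply, hx]
  have n1 : ∀ i, w.1 i ∈ S := hw1
  have n2 : ∀ i, w.2 i ∉ S := hw2
  rcases a with a | a <;> rcases b with b | b <;> simp only [Sum.elim_inl, Sum.elim_inr,
    Matrix.fromBlocks_apply₁₁, Matrix.fromBlocks_apply₁₂, Matrix.fromBlocks_apply₂₁,
    Matrix.fromBlocks_apply₂₂, Matrix.of_apply, Matrix.zero_apply]
  · rw [hp _ _ (by simp [n1]), hq _ _ (by simp [n1]), add_zero]
  · rw [hq _ _ (by simp [n1, n2]), add_zero]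
  · rw [hp _ _ (by simp [n1, n2]), zero_add]
  · rw [hp _ _ (by simp [n2]), hq _ _ (by simp [n2]), add_zero]

theorem fredholmTerm_offDiag_odd (hS : MeasurableSet S) (hμ : ∀ᵐ z ∂μ, z ∈ S)
    (hν : ∀ᵐ z ∂ν, z ∉ S) {p q : Z → Z → ℂ} (hp : ∀ x y, ¬(x ∈ S ∧ y ∉ S) → p x y = 0)
    (hq : ∀ x y, ¬(x ∉ S ∧ y ∈ S) → q x y = 0) (z : ℂ) (m : ℕ)
    (hint : Integrable (fredholmMinor (fun x y => p x y + q x y) (2 * m + 1))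
      (Measure.pi fun _ => μ + ν)) :
    fredholmTerm (μ + ν) (fun x y => p x y + q x y) z (2 * m + 1) = 0 := by
  rw [fredholmTerm, integral_pi_add hS hμ hν _ hint, Finset.sum_eq_zero, mul_zero]
  exact fun T _ => integral_minor_box_eq_zero hμ hν hp hq T (by omega)

/-- Only subsets of size m contribute, all equally. Their number over (2m)! is 1/(m!)², and the
block sign (-1)^m combines with z^{2m} to (-z²)^m. -/
theorem fredholmTerm_offDiag_even (hS : MeasurableSet S) (hμ : ∀ᵐ z ∂μ, z ∈ S)
    (hν : ∀ᵐ z ∂ν, z ∉ S) {p q : Z → Z → ℂ} (hp : ∀ x y, ¬(x ∈ S ∧ y ∉ S) → p x y = 0)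
    (hq : ∀ x y, ¬(x ∉ S ∧ y ∈ S) → q x y = 0) (z : ℂ) (m : ℕ)
    (hint : Integrable (fredholmMinor (fun x y => p x y + q x y) (2 * m))
      (Measure.pi fun _ => μ + ν)) :
    fredholmTerm (μ + ν) (fun x y => p x y + q x y) z (2 * m) =
      (-z ^ 2) ^ m / (m.factorial : ℂ) ^ 2 *
        ∫ w : (Fin m → Z) × (Fin m → Z), (Matrix.of fun a b => p (w.1 a) (w.2 b)).det *
          (Matrix.of fun a b => q (w.2 a) (w.1 b)).det
          ∂((Measure.pi fun _ : Fin m => μ).prod (Measure.pi fun _ : Fin m => ν)) := by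
  set J := ∫ w : (Fin m → Z) × (Fin m → Z), (Matrix.of fun a b => p (w.1 a) (w.2 b)).det *
          (Matrix.of fun a b => q (w.2 a) (w.1 b)).det
          ∂((Measure.pi fun _ : Fin m => μ).prod (Measure.pi fun _ : Fin m => ν)) with hJ
  have hT : ∀ T : Finset (Fin (2 * m)), ∫ x, fredholmMinor (fun x y => p x y + q x y) (2 * m) x
      ∂(Measure.pi fun a => if a ∈ T then μ else ν) = if T.card = m then (-1) ^ m * J else 0 :=
    fun T => by
      split_ifs with h
      · exact integral_minor_box hμ hν hp hq T h
      · exact integral_minor_box_eq_zero hμ hν hp hq T (by omega)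
  have hcard : (Finset.univ.filter fun T : Finset (Fin (2 * m)) => T.card = m).card
      = (2 * m).choose m := by
    rw [Finset.univ_filter_card_eq, Finset.card_powersetCard, Finset.card_univ, Fintype.card_fin]
  have hch : ((2 * m).choose m : ℂ) * (m.factorial : ℂ) ^ 2 = ((2 * m).factorial : ℂ) := by
    have := Nat.choose_mul_factorial_mul_factorial (show m ≤ 2 * m by omega)
    rw [show 2 * m - m = m by omega] at this
    rw [← this]; push_cast; ring
  rw [fredholmTerm, integral_pi_add hS hμ hν _ hint, Finset.sum_congr rfl fun T _ => hT T,
    ← Finset.sum_filter, Finset.sum_const, hcard, nsmul_eq_mul, ← hch]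
  have h1 : ((2 * m).choose m : ℂ) ≠ 0 := by
    exact_mod_cast (Nat.choose_pos (show m ≤ 2 * m by omega)).ne'
  have h2 : (m.factorial : ℂ) ≠ 0 := by exact_mod_cast m.factorial_ne_zero
  rw [pow_mul, neg_pow (z ^ 2), neg_sq]
  field_simp

end OffDiagonal

/-! ### Minors of a composed kernel. -/

section Composition

variable {W X Y : Type*} [MeasurableSpace W] [MeasurableSpace X] [MeasurableSpace Y]

/-- `∫ det (DAC) = (1/m!) ∫∫ det A det (CD)`. -/
theorem integral_minor_comp {ρ : Measure W} {μ : Measure X} {ν : Measure Y} [SigmaFinite ρ]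
    [SigmaFinite μ] [SigmaFinite ν] {S : Set W} (hS : ∀ᵐ t ∂ρ, t ∈ S)
    {D : W → X → ℂ} {A : X → Y → ℂ} {C : Y → W → ℂ}
    (hD : Measurable (Function.uncurry D)) (hA : Measurable (Function.uncurry A))
    (hC : Measurable (Function.uncurry C))
    {d : W → ℝ} {α : X → ℝ} {β : Y → ℝ} (hd0 : ∀ t, 0 ≤ d t) (hα0 : ∀ x, 0 ≤ α x)
    (hβ0 : ∀ y, 0 ≤ β y) (hd : Integrable (fun t => d t * d t) ρ)
    (hα : Integrable (fun x => α x * α x) μ) (hβ : Integrable (fun y => β y * β y) ν)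
    (hDb : ∀ t ∈ S, ∀ x, ‖D t x‖ ≤ d t * α x) (hAb : ∀ x y, ‖A x y‖ ≤ α x * β y)
    (hCb : ∀ t ∈ S, ∀ y, ‖C y t‖ ≤ β y * d t) (m : ℕ) :
    ∫ t, fredholmMinor (fun t t' => ∫ x, D t x * ∫ y, A x y * C y t' ∂ν ∂μ) m t
        ∂(Measure.pi fun _ : Fin m => ρ) =
      (m.factorial : ℂ)⁻¹ * ∫ w : (Fin m → X) × (Fin m → Y),
        (Matrix.of fun a b => A (w.1 a) (w.2 b)).det *
          (Matrix.of fun a b => ∫ t, C (w.2 a) t * D t (w.1 b) ∂ρ).det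
          ∂((Measure.pi fun _ : Fin m => μ).prod (Measure.pi fun _ : Fin m => ν)) := by
  have hm0 : (m.factorial : ℂ) ≠ 0 := by exact_mod_cast m.factorial_ne_zero
  have mD : ∀ t, Measurable (D t) := fun t => hD.comp measurable_prodMk_left
  have mD' : ∀ x, Measurable fun t => D t x := fun x => hD.comp measurable_prodMk_right
  have mA : ∀ x, Measurable (A x) := fun x => hA.comp measurable_prodMk_left
  have mC : ∀ y, Measurable (C y) := fun y => hC.comp measurable_prodMk_left
  have mC' : ∀ t, Measurable fun y => C y t := fun t => hC.comp measurable_prodMk_right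
  have iAC : ∀ x, ∀ t ∈ S, Integrable (fun y => A x y * C y t) ν := fun x t ht => by
    refine (hβ.const_mul (α x * d t)).mono' ((mA x).mul (mC' t)).aestronglyMeasurable
      (.of_forall fun y => ?_)
    rw [norm_mul]
    calc ‖A x y‖ * ‖C y t‖ ≤ (α x * β y) * (β y * d t) := by
          gcongr
          · exact mul_nonneg (hα0 x) (hβ0 y)
          · exact hAb x y
          · exact hCb t ht y
      _ = _ := by ring
  have mAC : ∀ t, Measurable fun x => ∫ y, A x y * C y t ∂ν := fun t => by
    refine (StronglyMeasurable.integral_prod_right (f := fun x y => A x y * C y t)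
      (Measurable.stronglyMeasurable ?_)).measurable
    exact hA.mul ((mC' t).comp measurable_snd)
  have bAC : ∀ x, ∀ t ∈ S, ‖∫ y, A x y * C y t ∂ν‖ ≤ α x * d t * ∫ y, β y * β y ∂ν :=
    fun x t ht => by
      rw [← integral_const_mul]
      refine norm_integral_le_of_norm_le (hβ.const_mul _) (.of_forall fun y => ?_)
      rw [norm_mul]
      calc ‖A x y‖ * ‖C y t‖ ≤ (α x * β y) * (β y * d t) := by
            gcongr
            · exact mul_nonneg (hα0 x) (hβ0 y)
            · exact hAb x y
            · exact hCb t ht y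
        _ = _ := by ring
  have iDAC : ∀ t ∈ S, ∀ t' ∈ S, Integrable (fun x => D t x * ∫ y, A x y * C y t' ∂ν) μ :=
    fun t ht t' ht' => by
      refine (hα.const_mul (d t * d t' * ∫ y, β y * β y ∂ν)).mono'
        ((mD t).mul (mAC t')).aestronglyMeasurable (.of_forall fun x => ?_)
      rw [norm_mul]
      calc ‖D t x‖ * ‖∫ y, A x y * C y t' ∂ν‖
          ≤ (d t * α x) * (α x * d t' * ∫ y, β y * β y ∂ν) := by
            gcongr
            · exact mul_nonneg (hd0 t) (hα0 x)
            · exact hDb t ht x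
            · exact bAC x t' ht'
        _ = _ := by ring
  have iCD : ∀ x y, Integrable (fun t => C y t * D t x) ρ := fun x y => by
    refine (hd.const_mul (β y * α x)).mono' ((mC y).mul (mD' x)).aestronglyMeasurable ?_
    filter_upwards [hS] with t ht
    rw [norm_mul]
    calc ‖C y t‖ * ‖D t x‖ ≤ (β y * d t) * (d t * α x) := by
          gcongr
          · exact mul_nonneg (hβ0 y) (hd0 t)
          · exact hCb t ht y
          · exact hDb t ht x
      _ = _ := by ring
  set dD : (Fin m → W) → (Fin m → X) → ℂ := fun t x => (Matrix.of fun a b => D (t a) (x b)).det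
  set dA : (Fin m → X) → (Fin m → Y) → ℂ := fun x y => (Matrix.of fun a b => A (x a) (y b)).det
  set dC : (Fin m → Y) → (Fin m → W) → ℂ := fun y t => (Matrix.of fun a b => C (y a) (t b)).det
  set ρm := Measure.pi fun _ : Fin m => ρ
  set μm := Measure.pi fun _ : Fin m => μ
  set νm := Measure.pi fun _ : Fin m => ν
  -- Absolute integrability for Fubini: of the three Hadamard bounds, each of `d`, `α`, `β` occurs
  -- in two, hence the square integrability assumptions and the cube of √(m^m).
  have hint : Integrable (fun v : (Fin m → W) × ((Fin m → X) × (Fin m → Y)) =>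
      dD v.1 v.2.1 * (dA v.2.1 v.2.2 * dC v.2.2 v.1)) (ρm.prod (μm.prod νm)) := by
    have h1 : Integrable (fun t => ∏ a, (d (t a) * d (t a))) ρm :=
      Integrable.fintype_prod fun _ => hd
    have h2 : Integrable (fun t => ∏ a, (α (t a) * α (t a))) μm :=
      Integrable.fintype_prod fun _ => hα
    have h3 : Integrable (fun t => ∏ a, (β (t a) * β (t a))) νm :=
      Integrable.fintype_prod fun _ => hβ
    refine ((h1.mul_prod (h2.mul_prod h3)).const_mul (√((m : ℝ) ^ m) ^ 3)).mono' ?_ ?_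
    · refine Measurable.aestronglyMeasurable ?_
      refine Measurable.mul ?_ (Measurable.mul ?_ ?_)
      · refine measurable_matrix_det fun a b => ?_
        exact hD.comp (f := fun v : (Fin m → W) × ((Fin m → X) × (Fin m → Y)) =>
          (v.1 a, v.2.1 b)) (by fun_prop)
      · refine measurable_matrix_det fun a b => ?_
        exact hA.comp (f := fun v : (Fin m → W) × ((Fin m → X) × (Fin m → Y)) =>
          (v.2.1 a, v.2.2 b)) (by fun_prop)
      · refine measurable_matrix_det fun a b => ?_
        exact hC.comp (f := fun v : (Fin m → W) × ((Fin m → X) × (Fin m → Y)) =>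
          (v.2.2 a, v.1 b)) (by fun_prop)
    · filter_upwards [Measure.quasiMeasurePreserving_fst.ae (ae_pi_forall_mem hS m)] with v hv
      have b1 := norm_det_le (Matrix.of fun a b => D (v.1 a) (v.2.1 b)) (fun a => d (v.1 a))
        (fun a => α (v.2.1 a)) (fun _ => hd0 _) (fun _ => hα0 _) fun a b => hDb _ (hv a) _
      have b2 := norm_det_le (Matrix.of fun a b => A (v.2.1 a) (v.2.2 b)) (fun a => α (v.2.1 a))
        (fun a => β (v.2.2 a)) (fun _ => hα0 _) (fun _ => hβ0 _) fun a b => hAb _ _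
      have b3 := norm_det_le (Matrix.of fun a b => C (v.2.2 a) (v.1 b)) (fun a => β (v.2.2 a))
        (fun a => d (v.1 a)) (fun _ => hβ0 _) (fun _ => hd0 _) fun a b => hCb _ (hv b) _
      rw [norm_mul, norm_mul]
      refine (mul_le_mul b1 (mul_le_mul b2 b3 (norm_nonneg _) ((norm_nonneg _).trans b2))
        (by positivity) ((norm_nonneg _).trans b1)).trans_eq ?_
      simp only [Finset.prod_mul_distrib]
      ring
  -- Andréief in the y variables for det(AC) and in the x variables for det(DAC) costs 1/(m!)².
  have step1 : ∀ᵐ t ∂ρm, fredholmMinor (fun t t' => ∫ x, D t x * ∫ y, A x y * C y t' ∂ν ∂μ) m t =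
      ((m.factorial : ℂ)⁻¹) ^ 2 *
        ∫ w : (Fin m → X) × (Fin m → Y), dD t w.1 * (dA w.1 w.2 * dC w.2 t) ∂(μm.prod νm) := by
    filter_upwards [ae_pi_forall_mem hS m, hint.prod_right_ae] with t ht hti
    have e1 := integral_det_mul_det μ (fun a x => D (t a) x)
      (fun b x => ∫ y, A x y * C y (t b) ∂ν) fun a b => iDAC _ (ht a) _ (ht b)
    have e2 : ∀ x : Fin m → X, ∫ y, dA x y * dC y t ∂νm =
        m.factorial * (Matrix.of fun a b => ∫ y, A (x a) y * C y (t b) ∂ν).det := fun x =>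
      integral_det_mul_det ν (fun a y => A (x a) y) (fun b y => C y (t b)) fun a b =>
        iAC _ _ (ht b)
    rw [integral_prod _ hti]
    simp only [integral_const_mul, e2]
    have e3 : ∫ x : Fin m → X, dD t x *
        ((m.factorial : ℂ) * (Matrix.of fun a b => ∫ y, A (x a) y * C y (t b) ∂ν).det) ∂μm =
        m.factorial * (m.factorial * fredholmMinor
          (fun t t' => ∫ x, D t x * ∫ y, A x y * C y t' ∂ν ∂μ) m t) := by
      rw [fredholmMinor, ← e1, ← integral_const_mul]
      exact integral_congr_ae (.of_forall fun x => by simp only [dD]; ring)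
    rw [e3]
    field_simp
  -- After exchanging the integrals, Andréief in t restores one factor m!.
  have step2 : ∀ x y, ∫ t, dD t x * (dA x y * dC y t) ∂ρm =
      m.factorial * (dA x y * (Matrix.of fun a b => ∫ t, C (y a) t * D t (x b) ∂ρ).det) :=
    fun x y => by
      have e1 := integral_det_mul_det ρ (fun a t => C (y a) t) (fun b t => D t (x b))
        fun a b => iCD _ _
      rw [mul_left_comm, ← e1, ← integral_const_mul]
      exact integral_congr_ae (.of_forall fun t => by simp only [dD, dA, dC]; ring)
  rw [integral_congr_ae step1, integral_const_mul,
    integral_integral_swap (f := fun t (w : (Fin m → X) × (Fin m → Y)) =>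
      dD t w.1 * (dA w.1 w.2 * dC w.2 t)) hint]
  simp only [step2, integral_const_mul]
  field_simp
  rfl

end Composition

/-! ### Trace class operators from series of rank one kernels. -/

section Nuclear

variable {X : Type*} [MeasurableSpace X] {m : Measure X}

theorem norm_toLp_two_sq {f : X → ℂ} (hf : MemLp f 2 m) :
    ‖hf.toLp f‖ ^ 2 = ∫ x, ‖f x‖ ^ 2 ∂m := by
  have h := L2.inner_def (𝕜 := ℂ) (hf.toLp f) (hf.toLp f)
  rw [inner_self_eq_norm_sq_to_K] at h
  have h2 : ∫ x, inner ℂ (hf.toLp f x) (hf.toLp f x) ∂m = ((∫ x, ‖f x‖ ^ 2 ∂m : ℝ) : ℂ) := by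
    rw [← integral_complex_ofReal]
    refine integral_congr_ae ?_
    filter_upwards [hf.coeFn_toLp] with x hx
    rw [hx, inner_self_eq_norm_sq_to_K]
    push_cast
    rfl
  rw [h2] at h
  exact Complex.ofReal_injective (by simpa using h)

theorem memLp_two_of_sq_le {f : X → ℂ} (hf : Measurable f) {F : X → ℝ} (hF : Integrable F m)
    (h : ∀ᵐ x ∂m, ‖f x‖ ^ 2 ≤ F x) : MemLp f 2 m := by
  rw [memLp_two_iff_integrable_sq_norm hf.aestronglyMeasurable]
  refine hF.mono' (hf.norm.pow_const 2).aestronglyMeasurable ?_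
  filter_upwards [h] with x hx
  simpa using hx

theorem summable_norm_toLp_sq {S : Set X} (hS : ∀ᵐ x ∂m, x ∈ S) {a : ℕ → X → ℂ} {F : X → ℝ}
    (hF : Integrable F m) (hFa : ∀ x ∈ S, ∀ t : Finset ℕ, ∑ i ∈ t, ‖a i x‖ ^ 2 ≤ F x)
    (ha : ∀ i, MemLp (a i) 2 m) : Summable fun i => ‖(ha i).toLp (a i)‖ ^ 2 := by
  refine summable_of_sum_le (c := ∫ x, F x ∂m) (fun i => by positivity) fun t => ?_
  simp only [norm_toLp_two_sq]
  have hint : ∀ i, Integrable (fun x => ‖a i x‖ ^ 2) m := fun i =>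
    (memLp_two_iff_integrable_sq_norm (ha i).1).1 (ha i)
  rw [← integral_finsetSum _ fun i _ => hint i]
  refine integral_mono_ae (integrable_finsetSum _ fun i _ => hint i) hF ?_
  filter_upwards [hS] with x hx using hFa x hx t

theorem integral_norm_mul_le {f h : X → ℂ} (hf : MemLp f 2 m) (hh : MemLp h 2 m) :
    ∫ y, ‖f y * h y‖ ∂m ≤ ‖hf.toLp f‖ * ‖hh.toLp h‖ := by
  have hm1 : MemLp (fun y => (‖f y‖ : ℂ)) 2 m := hf.norm.ofReal
  have hm2 : MemLp (fun y => (‖h y‖ : ℂ)) 2 m := hh.norm.ofReal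
  have e1 : inner ℂ (hm1.toLp _) (hm2.toLp _) = ((∫ y, ‖f y * h y‖ ∂m : ℝ) : ℂ) := by
    rw [L2.inner_def, ← integral_complex_ofReal]
    refine integral_congr_ae ?_
    filter_upwards [hm1.coeFn_toLp, hm2.coeFn_toLp] with y hy1 hy2
    rw [hy1, hy2]
    simp [mul_comm]
  have e2 := norm_inner_le_norm (𝕜 := ℂ) (hm1.toLp _) (hm2.toLp _)
  rw [e1, Complex.norm_real] at e2
  have n1 : ‖hm1.toLp _‖ = ‖hf.toLp f‖ := by
    rw [← sq_eq_sq₀ (norm_nonneg _) (norm_nonneg _), norm_toLp_two_sq, norm_toLp_two_sq]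
    simp
  have n2 : ‖hm2.toLp _‖ = ‖hh.toLp h‖ := by
    rw [← sq_eq_sq₀ (norm_nonneg _) (norm_nonneg _), norm_toLp_two_sq, norm_toLp_two_sq]
    simp
  rw [n1, n2] at e2
  exact (le_abs_self _).trans e2

theorem norm_hasSum_mul_sq_le {a b : ℕ → ℂ} {F G : ℝ} (ha : ∀ t : Finset ℕ, ∑ i ∈ t, ‖a i‖ ^ 2 ≤ F)
    (hb : ∀ t : Finset ℕ, ∑ i ∈ t, ‖b i‖ ^ 2 ≤ G) {z : ℂ} (h : HasSum (fun i => a i * b i) z) :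
    ‖z‖ ^ 2 ≤ F * G := by
  have hF : 0 ≤ F := by simpa using ha ∅
  refine le_of_tendsto ((continuous_norm.tendsto z).comp h |>.pow 2) (.of_forall fun t => ?_)
  calc ‖∑ i ∈ t, a i * b i‖ ^ 2 ≤ (∑ i ∈ t, ‖a i‖ * ‖b i‖) ^ 2 := by
        gcongr
        exact (norm_sum_le _ _).trans_eq (by simp)
    _ ≤ (∑ i ∈ t, ‖a i‖ ^ 2) * ∑ i ∈ t, ‖b i‖ ^ 2 := Finset.sum_mul_sq_le_sq_mul_sq _ _ _
    _ ≤ F * G := by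
        gcongr
        · exact ha t
        · exact hb t

/-- Sum and integral may be exchanged because ∑ |α_i| ∫ |b_i h| ≤ ‖h‖ ∑ |α_i| ‖b_i‖, finite as both
factors are square summable. -/
theorem hasSum_integral_of_sq_summable {S : Set X} (hS : ∀ᵐ x ∂m, x ∈ S) {α : ℕ → ℂ} {F : ℝ}
    (hF : ∀ t : Finset ℕ, ∑ i ∈ t, ‖α i‖ ^ 2 ≤ F) {b : ℕ → X → ℂ} {G : X → ℝ}
    (hb : ∀ i, MemLp (b i) 2 m) (hG : Integrable G m)
    (hGb : ∀ x ∈ S, ∀ t : Finset ℕ, ∑ i ∈ t, ‖b i x‖ ^ 2 ≤ G x) {κ : X → ℂ}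
    (hκ : ∀ y ∈ S, HasSum (fun i => α i * b i y) (κ y)) {h : X → ℂ}
    (hh : MemLp h 2 m) :
    Integrable (fun y => κ y * h y) m ∧
      HasSum (fun i => (∫ y, b i y * h y ∂m) * α i) (∫ y, κ y * h y ∂m) := by
  have hF0 : 0 ≤ F := by simpa using hF ∅
  have hterm : ∀ i, Integrable (fun y => α i * (b i y * h y)) m := fun i =>
    ((hb i).integrable_mul hh).const_mul _
  have hsn : Summable fun i => ∫ y, ‖α i * (b i y * h y)‖ ∂m := by
    refine Summable.of_nonneg_of_le (fun i => integral_nonneg fun y => norm_nonneg _) (fun i => ?_)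
      (((summable_of_sum_le (fun i => by positivity) hF).add
        (summable_norm_toLp_sq hS hG hGb hb)).mul_right ‖hh.toLp h‖)
    simp only [norm_mul (α i), integral_const_mul]
    calc ‖α i‖ * ∫ y, ‖b i y * h y‖ ∂m ≤ ‖α i‖ * (‖(hb i).toLp (b i)‖ * ‖hh.toLp h‖) := by
          gcongr
          exact integral_norm_mul_le (hb i) hh
      _ = ‖α i‖ * ‖(hb i).toLp (b i)‖ * ‖hh.toLp h‖ := by ring
      _ ≤ _ := by
        gcongr
        nlinarith [sq_nonneg (‖α i‖ - ‖(hb i).toLp (b i)‖), sq_nonneg ‖α i‖,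
          sq_nonneg ‖(hb i).toLp (b i)‖]
  have hpt : ∀ y ∈ S, HasSum (fun i => α i * (b i y * h y)) (κ y * h y) := fun y hy => by
    have := (hκ y hy).mul_right (h y)
    simp only [mul_assoc] at this
    exact this
  have hint := hasSum_integral_of_summable_integral_norm hterm hsn
  have hae : (fun y => ∑' i, α i * (b i y * h y)) =ᵐ[m] fun y => κ y * h y := by
    filter_upwards [hS] with y hy using (hpt y hy).tsum_eq
  rw [integral_congr_ae hae] at hint
  constructor
  -- `κ` is not assumed measurable; the product is an almost everywhere limit of measurable partial
  -- sums.
  · have hm : AEStronglyMeasurable (fun y => κ y * h y) m := by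
      refine aestronglyMeasurable_of_tendsto_ae atTop
        (f := fun (n : ℕ) y => ∑ i ∈ Finset.range n, α i * (b i y * h y))
        (fun n => (integrable_finsetSum _ fun i _ => hterm i).aestronglyMeasurable) ?_
      filter_upwards [hS] with y hy using (hpt y hy).tendsto_sum_nat
    have hgt : Integrable (fun y => F * G y + ‖h y‖ ^ 2) m :=
      (hG.const_mul _).add ((memLp_two_iff_integrable_sq_norm hh.1).1 hh)
    refine hgt.mono' hm ?_
    filter_upwards [hS] with y hy
    have := norm_hasSum_mul_sq_le hF (hGb y hy) (hκ y hy)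
    rw [norm_mul]
    nlinarith [sq_nonneg (‖κ y‖ - ‖h y‖), sq_nonneg ‖κ y‖, sq_nonneg ‖h y‖]
  · have e : ∀ i, ∫ y, α i * (b i y * h y) ∂m = (∫ y, b i y * h y ∂m) * α i := fun i => by
      rw [integral_const_mul, mul_comm]
    simp only [e] at hint
    exact hint

theorem exists_hasSum_rankOne {E : Type*} [NormedAddCommGroup E] [InnerProductSpace ℂ E]
    [CompleteSpace E] {C A : ℕ → E} (h : Summable fun i => ‖C i‖ * ‖A i‖) :
    ∃ T : E →L[ℂ] E, ∀ x, HasSum (fun i => inner ℂ (C i) x • A i) (T x) := by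
  have hR : ∃ R : ℕ → (E →L[ℂ] E), ∀ i, R i = (innerSL ℂ (C i)).smulRight (A i) := ⟨_, fun i => rfl⟩
  obtain ⟨R, hR⟩ := hR
  have hn : ∀ i, ‖R i‖ = ‖C i‖ * ‖A i‖ := fun i => by
    rw [hR, ContinuousLinearMap.norm_smulRight_apply, innerSL_apply_norm]
  have sR : Summable R := Summable.of_norm_bounded h fun i => (hn i).le
  refine ⟨∑' i, R i, fun x => ?_⟩
  have h1 := sR.hasSum.mapL (ContinuousLinearMap.apply ℂ E x)
  simp only [ContinuousLinearMap.apply_apply] at h1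
  simpa only [ContinuousLinearMap.smulRight_apply, innerSL_apply_apply, hR] using h1

/-- A kernel `k(x, y) = ∑ a_i(x) b_i(y)` with square summable factors defines a trace class
operator. -/
theorem exists_traceClass_of_hasSum {S : Set X} (hS : ∀ᵐ x ∂m, x ∈ S) {a b : ℕ → X → ℂ}
    (ha : ∀ i, Measurable (a i)) (hb : ∀ i, Measurable (b i)) {F G : X → ℝ}
    (hF : Integrable F m) (hG : Integrable G m)
    (hFa : ∀ x ∈ S, ∀ t : Finset ℕ, ∑ i ∈ t, ‖a i x‖ ^ 2 ≤ F x)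
    (hGb : ∀ x ∈ S, ∀ t : Finset ℕ, ∑ i ∈ t, ‖b i x‖ ^ 2 ≤ G x)
    {k : X → X → ℂ} (hk : ∀ x ∈ S, ∀ y ∈ S, HasSum (fun i => a i x * b i y) (k x y)) :
    ∃ T : Lp ℂ 2 m →L[ℂ] Lp ℂ 2 m, IsIntegralOperator m k T ∧ IsTraceClass T := by
  have mA : ∀ i, MemLp (a i) 2 m := fun i => memLp_two_of_sq_le (ha i) hF <| by
    filter_upwards [hS] with x hx using by simpa using hFa x hx {i}
  have mB : ∀ i, MemLp (b i) 2 m := fun i => memLp_two_of_sq_le (hb i) hG <| by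
    filter_upwards [hS] with x hx using by simpa using hGb x hx {i}
  -- Conjugated, since the inner product is conjugate linear in its first argument.
  have mC : ∀ i, MemLp (fun x => (starRingEnd ℂ) (b i x)) 2 m := fun i => (mB i).star
  obtain ⟨A, hA⟩ : ∃ A : ℕ → Lp ℂ 2 m, ∀ i, A i = (mA i).toLp (a i) := ⟨_, fun i => rfl⟩
  obtain ⟨C, hC⟩ : ∃ C : ℕ → Lp ℂ 2 m,
      ∀ i, C i = (mC i).toLp fun x => (starRingEnd ℂ) (b i x) := ⟨_, fun i => rfl⟩
  have sA : Summable fun i => ‖A i‖ ^ 2 := by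
    simp only [hA]
    exact summable_norm_toLp_sq hS hF hFa mA
  have sC : Summable fun i => ‖C i‖ ^ 2 := by
    simp only [hC]
    exact summable_norm_toLp_sq hS hG (fun x hx t => by simpa using hGb x hx t) mC
  have sCA : Summable fun i => ‖C i‖ * ‖A i‖ := by
    refine Summable.of_nonneg_of_le (fun i => by positivity) (fun i => ?_) (sC.add sA)
    nlinarith [sq_nonneg (‖C i‖ - ‖A i‖), sq_nonneg ‖C i‖, sq_nonneg ‖A i‖]
  obtain ⟨T, hT⟩ := exists_hasSum_rankOne sCA
  refine ⟨T, fun h => ?_, C, A, sCA, hT⟩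
  have hinner : ∀ i, inner ℂ (C i) h = ∫ y, b i y * h y ∂m := fun i => by
    rw [L2.inner_def]
    refine integral_congr_ae ?_
    filter_upwards [(mC i).coeFn_toLp] with y hy
    rw [hC, hy]
    simp [mul_comm]
  have hnorm : ∑' i, ‖inner ℂ (C i) h • A i‖ₑ ≠ ⊤ := by
    have : Summable fun i => ‖inner ℂ (C i) h • A i‖ := by
      refine Summable.of_nonneg_of_le (fun i => norm_nonneg _) (fun i => ?_) (sCA.mul_right ‖h‖)
      rw [norm_smul]
      calc _ ≤ ‖C i‖ * ‖h‖ * ‖A i‖ := by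
            gcongr
            exact norm_inner_le_norm _ _
        _ = _ := by ring
    simp only [enorm_eq_nnnorm]
    rw [ENNReal.tsum_coe_ne_top_iff_summable, ← NNReal.summable_coe]
    exact this
  have hcoe : ∀ᵐ x ∂m, ∀ i, (inner ℂ (C i) h • A i : Lp ℂ 2 m) x
      = (∫ y, b i y * h y ∂m) * a i x := by
    rw [ae_all_iff]
    intro i
    filter_upwards [Lp.coeFn_smul (inner ℂ (C i) h) (A i), (mA i).coeFn_toLp] with x h1 h2
    rw [h1, Pi.smul_apply, hA, h2, hinner, smul_eq_mul]
  -- An absolutely convergent series in L² also converges pointwise almost everywhere, so its sum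
  -- can be compared with the pointwise expansion of ∫ k(x, y) h(y) dy.
  filter_upwards [hS, Lp.hasSum_coeFn_tsum hnorm, hcoe] with x hx hsum hco
  obtain ⟨hi, hs⟩ := hasSum_integral_of_sq_summable hS (hFa x hx) mB hG hGb (hk x hx) (Lp.memLp h)
  refine ⟨hi, ?_⟩
  rw [← (hT h).tsum_eq]
  simp only [hco] at hsum
  exact hsum.unique hs

/-- The composition of integral operators with kernels `D`, `A = ∑ a_i ⊗ b_i`, `C` is trace
class. -/
theorem exists_traceClass_comp {W Y : Type*} [MeasurableSpace W] [MeasurableSpace Y]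
    {ρ : Measure W} {ν : Measure Y} [SigmaFinite m] [SigmaFinite ν]
    {S : Set W} (hS : ∀ᵐ t ∂ρ, t ∈ S)
    {D : W → X → ℂ} {A : X → Y → ℂ} {C : Y → W → ℂ} {a : ℕ → X → ℂ} {b : ℕ → Y → ℂ}
    (hD : Measurable (Function.uncurry D)) (hC : Measurable (Function.uncurry C))
    (ha : ∀ i, Measurable (a i)) (hb : ∀ i, Measurable (b i))
    {d : W → ℝ} {α : X → ℝ} {β : Y → ℝ}
    (hd : Integrable (fun t => d t ^ 2) ρ)
    (hα : Integrable (fun x => α x ^ 2) m) (hβ : Integrable (fun y => β y ^ 2) ν)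
    (hDb : ∀ t ∈ S, ∀ x, ‖D t x‖ ≤ d t * α x) (hCb : ∀ t ∈ S, ∀ y, ‖C y t‖ ≤ β y * d t)
    (haα : ∀ x, ∀ u : Finset ℕ, ∑ i ∈ u, ‖a i x‖ ^ 2 ≤ α x ^ 2)
    (hbβ : ∀ y, ∀ u : Finset ℕ, ∑ i ∈ u, ‖b i y‖ ^ 2 ≤ β y ^ 2)
    (hA : ∀ x y, HasSum (fun i => a i x * b i y) (A x y)) :
    ∃ T : Lp ℂ 2 ρ →L[ℂ] Lp ℂ 2 ρ,
      IsIntegralOperator ρ (fun t t' => ∫ x, D t x * ∫ y, A x y * C y t' ∂ν ∂m) T ∧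
        IsTraceClass T := by
  have univ_m : ∀ᵐ x ∂m, x ∈ (Set.univ : Set X) := .of_forall fun _ => Set.mem_univ _
  have univ_ν : ∀ᵐ x ∂ν, x ∈ (Set.univ : Set Y) := .of_forall fun _ => Set.mem_univ _
  have La : ∀ i, MemLp (a i) 2 m := fun i =>
    memLp_two_of_sq_le (ha i) hα (.of_forall fun x => by simpa using haα x {i})
  have Lb : ∀ i, MemLp (b i) 2 ν := fun i =>
    memLp_two_of_sq_le (hb i) hβ (.of_forall fun x => by simpa using hbβ x {i})
  have sa := summable_norm_toLp_sq univ_m hα (fun x _ => haα x) La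
  have sb := summable_norm_toLp_sq univ_ν hβ (fun x _ => hbβ x) Lb
  have bD : ∀ t ∈ S, ∀ x, ‖D t x‖ ^ 2 ≤ d t ^ 2 * α x ^ 2 := fun t ht x => by
    rw [← mul_pow]
    exact pow_le_pow_left₀ (norm_nonneg _) (hDb t ht x) 2
  have bC : ∀ t ∈ S, ∀ y, ‖C y t‖ ^ 2 ≤ d t ^ 2 * β y ^ 2 := fun t ht y => by
    rw [← mul_pow, mul_comm (d t)]
    exact pow_le_pow_left₀ (norm_nonneg _) (hCb t ht y) 2
  have LD : ∀ t ∈ S, MemLp (D t) 2 m := fun t ht =>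
    memLp_two_of_sq_le (hD.comp measurable_prodMk_left) (hα.const_mul (d t ^ 2))
      (.of_forall (bD t ht))
  have LC : ∀ t ∈ S, MemLp (fun y => C y t) 2 ν := fun t ht =>
    memLp_two_of_sq_le (hC.comp measurable_prodMk_right) (hβ.const_mul (d t ^ 2))
      (.of_forall (bC t ht))
  have nD : ∀ t (ht : t ∈ S), ‖(LD t ht).toLp (D t)‖ ^ 2 ≤ d t ^ 2 * ∫ x, α x ^ 2 ∂m :=
    fun t ht => by
      rw [norm_toLp_two_sq, ← integral_const_mul]
      exact integral_mono_of_nonneg (.of_forall fun x => by positivity) (hα.const_mul _)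
        (.of_forall (bD t ht))
  have nC : ∀ t (ht : t ∈ S), ‖(LC t ht).toLp (fun y => C y t)‖ ^ 2 ≤
      d t ^ 2 * ∫ x, β x ^ 2 ∂ν := fun t ht => by
    rw [norm_toLp_two_sq, ← integral_const_mul]
    exact integral_mono_of_nonneg (.of_forall fun x => by positivity) (hβ.const_mul _)
      (.of_forall (bC t ht))
  have ba : ∀ t ∈ S, ∀ u : Finset ℕ, ∑ i ∈ u, ‖∫ x, a i x * D t x ∂m‖ ^ 2 ≤
      d t ^ 2 * ((∫ x, α x ^ 2 ∂m) * ∑' i, ‖(La i).toLp (a i)‖ ^ 2) := fun t ht u => by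
    calc ∑ i ∈ u, ‖∫ x, a i x * D t x ∂m‖ ^ 2
        ≤ ∑ i ∈ u, ‖(La i).toLp (a i)‖ ^ 2 * (d t ^ 2 * ∫ x, α x ^ 2 ∂m) := by
          refine Finset.sum_le_sum fun i _ => ?_
          refine le_trans (pow_le_pow_left₀ (norm_nonneg _) ((norm_integral_le_integral_norm _).trans
            (integral_norm_mul_le (La i) (LD t ht))) 2) ?_
          rw [mul_pow]
          gcongr
          exact nD t ht
      _ = (∑ i ∈ u, ‖(La i).toLp (a i)‖ ^ 2) * (d t ^ 2 * ∫ x, α x ^ 2 ∂m) := by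
          rw [Finset.sum_mul]
      _ ≤ (∑' i, ‖(La i).toLp (a i)‖ ^ 2) * (d t ^ 2 * ∫ x, α x ^ 2 ∂m) := by
          gcongr
          exact sa.sum_le_tsum u fun i _ => sq_nonneg _
      _ = _ := by ring
  have bb : ∀ t ∈ S, ∀ u : Finset ℕ, ∑ i ∈ u, ‖∫ x, b i x * C x t ∂ν‖ ^ 2 ≤
      d t ^ 2 * ((∫ x, β x ^ 2 ∂ν) * ∑' i, ‖(Lb i).toLp (b i)‖ ^ 2) := fun t ht u => by
    calc ∑ i ∈ u, ‖∫ x, b i x * C x t ∂ν‖ ^ 2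
        ≤ ∑ i ∈ u, ‖(Lb i).toLp (b i)‖ ^ 2 * (d t ^ 2 * ∫ x, β x ^ 2 ∂ν) := by
          refine Finset.sum_le_sum fun i _ => ?_
          refine le_trans (pow_le_pow_left₀ (norm_nonneg _) ((norm_integral_le_integral_norm _).trans
            (integral_norm_mul_le (Lb i) (LC t ht))) 2) ?_
          rw [mul_pow]
          gcongr
          exact nC t ht
      _ = (∑ i ∈ u, ‖(Lb i).toLp (b i)‖ ^ 2) * (d t ^ 2 * ∫ x, β x ^ 2 ∂ν) := by
          rw [Finset.sum_mul]
      _ ≤ (∑' i, ‖(Lb i).toLp (b i)‖ ^ 2) * (d t ^ 2 * ∫ x, β x ^ 2 ∂ν) := by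
          gcongr
          exact sb.sum_le_tsum u fun i _ => sq_nonneg _
      _ = _ := by ring
  -- The expansion of `A` passes through the integrals: DAC = ∑ (∫ D a_i)(∫ b_i C). By
  -- Cauchy-Schwarz the squares of the new factors sum to at most a constant times d(t)².
  refine exists_traceClass_of_hasSum (a := fun i t => ∫ x, a i x * D t x ∂m)
    (b := fun i t => ∫ x, b i x * C x t ∂ν) hS (fun i => ?_) (fun i => ?_) (hd.mul_const _)
    (hd.mul_const _) ba bb fun t ht t' ht' => ?_
  · refine (StronglyMeasurable.integral_prod_right (f := fun t x => a i x * D t x)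
      (Measurable.stronglyMeasurable ?_)).measurable
    exact ((ha i).comp measurable_snd).mul hD
  · refine (StronglyMeasurable.integral_prod_right (f := fun t x => b i x * C x t)
      (Measurable.stronglyMeasurable ?_)).measurable
    exact ((hb i).comp measurable_snd).mul (hC.comp measurable_swap)
  · have inner : ∀ x, HasSum (fun i => (∫ y, b i y * C y t' ∂ν) * a i x)
        (∫ y, A x y * C y t' ∂ν) := fun x =>
      (hasSum_integral_of_sq_summable univ_ν (haα x) Lb hβ (fun y _ => hbβ y)
        (fun y _ => hA x y) (LC t' ht')).2
    have outer := (hasSum_integral_of_sq_summable univ_m (bb t' ht') La hα (fun y _ => haα y)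
        (fun x _ => inner x) (LD t ht)).2
    simpa only [mul_comm (D t _)] using outer

/-- Interleave the two sequences of rank one operators over even and odd indices. -/
theorem IsTraceClass.add {E : Type*} [NormedAddCommGroup E] [InnerProductSpace ℂ E]
    {T U : E →L[ℂ] E} (hT : IsTraceClass T) (hU : IsTraceClass U) : IsTraceClass (T + U) := by
  obtain ⟨a, b, hab, hT⟩ := hT
  obtain ⟨c, d, hcd, hU⟩ := hU
  have e1 : ∀ i, Equiv.natSumNatEquivNat.symm (2 * i) = Sum.inl i := fun i => by
    rw [Equiv.symm_apply_eq]; rfl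
  have e2 : ∀ i, Equiv.natSumNatEquivNat.symm (2 * i + 1) = Sum.inr i := fun i => by
    rw [Equiv.symm_apply_eq]; rfl
  refine ⟨fun i => Sum.elim a c (Equiv.natSumNatEquivNat.symm i),
    fun i => Sum.elim b d (Equiv.natSumNatEquivNat.symm i), ?_, fun x => ?_⟩
  · refine (HasSum.even_add_odd (m := ∑' i, ‖a i‖ * ‖b i‖) (m' := ∑' i, ‖c i‖ * ‖d i‖)
      ?_ ?_).summable
    · simpa only [e1, Sum.elim_inl] using hab.hasSum
    · simpa only [e2, Sum.elim_inr] using hcd.hasSum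
  · refine HasSum.even_add_odd (m := T x) (m' := U x) ?_ ?_
    · simpa only [e1, Sum.elim_inl] using hT x
    · simpa only [e2, Sum.elim_inr] using hU x

theorem IsIntegralOperator.add {k l : X → X → ℂ} {T U : Lp ℂ 2 m →L[ℂ] Lp ℂ 2 m}
    (hT : IsIntegralOperator m k T) (hU : IsIntegralOperator m l U) :
    IsIntegralOperator m (fun x y => k x y + l x y) (T + U) := fun h => by
  filter_upwards [hT h, hU h, Lp.coeFn_add (T h) (U h)] with x h1 h2 h3
  simp only [add_mul]
  refine ⟨h1.1.add h2.1, ?_⟩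
  rw [add_apply, h3, Pi.add_apply, h1.2, h2.2, integral_add h1.1 h2.1]

end Nuclear

/-! ### Expansion of the Cauchy kernel by the Cayley transform. -/

section CauchyKernel

/-- The functions `((z - 1) / (z + 1))^i / (z + 1)`, which diagonalize the Cauchy kernel. -/
def cauchyFun (i : ℕ) (z : ℂ) : ℂ := ((z - 1) / (z + 1)) ^ i / (z + 1)

theorem measurable_cauchyFun (i : ℕ) : Measurable (cauchyFun i) := by
  unfold cauchyFun
  fun_prop

theorem add_one_ne_zero_of_re_pos {z : ℂ} (hz : 0 < z.re) : z + 1 ≠ 0 := fun h => by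
  have := congrArg Complex.re h
  simp at this
  linarith

/-- Points of the right half plane are closer to 1 than to -1. -/
theorem norm_sub_one_div_add_one_lt {z : ℂ} (hz : 0 < z.re) : ‖(z - 1) / (z + 1)‖ < 1 := by
  have h0 := add_one_ne_zero_of_re_pos hz
  rw [norm_div, div_lt_one (norm_pos_iff.2 h0)]
  refine lt_of_pow_lt_pow_left₀ 2 (norm_nonneg _) ?_
  rw [← Complex.normSq_eq_norm_sq, ← Complex.normSq_eq_norm_sq, Complex.normSq_apply,
    Complex.normSq_apply]
  simp
  nlinarith

/-- A geometric series, summed with |z + 1|² - |z - 1|² = 4 Re z. -/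
theorem hasSum_norm_cauchyFun_sq {z : ℂ} (hz : 0 < z.re) :
    HasSum (fun i => ‖cauchyFun i z‖ ^ 2) (1 / (4 * z.re)) := by
  have h0 := add_one_ne_zero_of_re_pos hz
  have h1 := norm_sub_one_div_add_one_lt hz
  have hq : ‖(z - 1) / (z + 1)‖ ^ 2 < 1 := pow_lt_one₀ (norm_nonneg _) h1 two_ne_zero
  have hg := (hasSum_geometric_of_lt_one (sq_nonneg _) hq).mul_left ((‖z + 1‖ ^ 2)⁻¹)
  have e1 : (fun i => ‖cauchyFun i z‖ ^ 2) =
      fun i => (‖z + 1‖ ^ 2)⁻¹ * (‖(z - 1) / (z + 1)‖ ^ 2) ^ i := by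
    funext i
    rw [cauchyFun, norm_div, norm_pow, div_pow, ← pow_mul, ← pow_mul, mul_comm i 2]
    ring
  have e2 : 1 / (4 * z.re) = (‖z + 1‖ ^ 2)⁻¹ * (1 - ‖(z - 1) / (z + 1)‖ ^ 2)⁻¹ := by
    have hn : ‖z + 1‖ ≠ 0 := norm_ne_zero_iff.2 h0
    have h4 : ‖z + 1‖ ^ 2 - ‖z - 1‖ ^ 2 = 4 * z.re := by
      rw [← Complex.normSq_eq_norm_sq, ← Complex.normSq_eq_norm_sq, Complex.normSq_apply,
        Complex.normSq_apply]
      simp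
      ring
    rw [← mul_inv, norm_div, div_pow, mul_sub, mul_one, mul_div_cancel₀ _ (pow_ne_zero 2 hn), h4,
      one_div]
  rw [e1, e2]
  exact hg

/-- With q(z) = (z - 1)/(z + 1), a geometric series summed by 1 - q(x)q(y) = 2(x + y)/((x + 1)(y +
1)). -/
theorem hasSum_cauchyFun_mul {x y : ℂ} (hx : 0 < x.re) (hy : 0 < y.re) :
    HasSum (fun i => 2 * cauchyFun i x * cauchyFun i y) (1 / (x + y)) := by
  have hx0 := add_one_ne_zero_of_re_pos hx
  have hy0 := add_one_ne_zero_of_re_pos hy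
  have hx1 := norm_sub_one_div_add_one_lt hx
  have hy1 := norm_sub_one_div_add_one_lt hy
  have hxy : x + y ≠ 0 := fun h => by
    have := congrArg Complex.re h
    simp at this
    linarith
  have hq : ‖(x - 1) / (x + 1) * ((y - 1) / (y + 1))‖ < 1 := by
    rw [norm_mul]
    exact mul_lt_one_of_nonneg_of_lt_one_left (norm_nonneg _) hx1 hy1.le
  have hg := (hasSum_geometric_of_norm_lt_one hq).mul_left (2 / ((x + 1) * (y + 1)))
  have e1 : (fun i => 2 * cauchyFun i x * cauchyFun i y) = fun i =>
      2 / ((x + 1) * (y + 1)) * ((x - 1) / (x + 1) * ((y - 1) / (y + 1))) ^ i := by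
    funext i
    rw [cauchyFun, cauchyFun, mul_pow]
    field_simp
  have e2 : 1 / (x + y) =
      2 / ((x + 1) * (y + 1)) * (1 - (x - 1) / (x + 1) * ((y - 1) / (y + 1)))⁻¹ := by
    have h2 : 1 - (x - 1) / (x + 1) * ((y - 1) / (y + 1))
        = 2 * (x + y) / ((x + 1) * (y + 1)) := by
      field_simp
      ring
    rw [h2]
    field_simp
  rw [e1, e2]
  exact hg

end CauchyKernel

/-! ### Arc length, unit tangent and contour integrals. -/

section ArcLength

variable {γ : ℝ → ℂ}

theorem unitTangent_apply (hi : Function.Injective γ) (t : ℝ) :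
    unitTangent γ (γ t) = deriv γ t / (‖deriv γ t‖ : ℂ) := by
  rw [unitTangent, Set.indicator_of_mem (Set.mem_range_self t), Function.leftInverse_invFun hi t]

theorem unitTangent_of_notMem {z : ℂ} (hz : z ∉ Set.range γ) : unitTangent γ z = 0 :=
  Set.indicator_of_notMem hz _

theorem norm_unitTangent_le (z : ℂ) : ‖unitTangent γ z‖ ≤ 1 := by
  rw [unitTangent]
  refine (norm_indicator_le_norm_self _ z).trans ?_
  rw [norm_div, Complex.norm_real, norm_norm]
  exact div_self_le_one _

theorem measurable_unitTangent (hc : Continuous γ) (hi : Function.Injective γ) :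
    Measurable (unitTangent γ) := by
  have h : unitTangent γ =
      Function.extend γ (fun t => deriv γ t / (‖deriv γ t‖ : ℂ)) fun _ => 0 := by
    funext z
    by_cases hz : z ∈ Set.range γ
    · obtain ⟨t, rfl⟩ := hz
      rw [unitTangent_apply hi, hi.extend_apply]
    · rw [unitTangent_of_notMem hz, Function.extend_apply' _ _ _ hz]
  rw [h]
  have := measurable_deriv γ
  exact (hc.measurableEmbedding hi).measurable_extend (by fun_prop) measurable_const

theorem measurable_curveInd (hc : Continuous γ) (hi : Function.Injective γ) :
    Measurable (curveInd γ) :=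
  measurable_const.indicator (hc.measurableEmbedding hi).measurableSet_range

theorem curveInd_apply (t : ℝ) : curveInd γ (γ t) = 1 :=
  Set.indicator_of_mem (Set.mem_range_self t) _

theorem curveInd_of_notMem {z : ℂ} (hz : z ∉ Set.range γ) : curveInd γ z = 0 :=
  Set.indicator_of_notMem hz _

theorem ae_arcLength_mem_range (hc : Continuous γ) (hi : Function.Injective γ) :
    ∀ᵐ z ∂(arcLength γ), z ∈ Set.range γ := by
  rw [arcLength, (hc.measurableEmbedding hi).ae_map_iff]
  exact .of_forall Set.mem_range_self

theorem integral_arcLength (hc : Continuous γ) (hi : Function.Injective γ) (f : ℂ → ℂ) :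
    ∫ z, f z ∂(arcLength γ) = ∫ t, (‖deriv γ t‖ : ℂ) * f (γ t) := by
  rw [arcLength, (hc.measurableEmbedding hi).integral_map]
  simp only [enorm_eq_nnnorm]
  rw [integral_withDensity_eq_integral_smul (measurable_deriv γ).nnnorm]
  rfl

theorem integrable_comp_mul_norm_deriv (hc : Continuous γ) (hi : Function.Injective γ) {f : ℂ → ℝ}
    (hf : Integrable f (arcLength γ)) : Integrable fun t => f (γ t) * ‖deriv γ t‖ := by
  rw [arcLength, (hc.measurableEmbedding hi).integrable_map_iff] at hf
  simp only [enorm_eq_nnnorm] at hf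
  rw [integrable_withDensity_iff_integrable_smul (measurable_deriv γ).nnnorm] at hf
  refine hf.congr (.of_forall fun t => ?_)
  simp [NNReal.smul_def, mul_comm]

theorem contourIntegral_eq (hc : Continuous γ) (hi : Function.Injective γ) (f : ℂ → ℂ) :
    contourIntegral γ f = ∫ z, f z * unitTangent γ z ∂(arcLength γ) := by
  rw [integral_arcLength hc hi, contourIntegral]
  refine integral_congr_ae (.of_forall fun t => ?_)
  simp only [unitTangent_apply hi]
  -- Where the derivative vanishes the tangent is 0/0 = 0, and both integrands are zero.
  by_cases h : deriv γ t = 0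
  · simp [h]
  · have : (‖deriv γ t‖ : ℂ) ≠ 0 := by simpa using h
    field_simp

/-- With k = ⌊‖z‖⌋ the integrand is at most e^{-k} on the ball of radius k + 1, whose measure is
only polynomial in k. -/
theorem integrable_exp_neg_norm {m : Measure ℂ} {C : ℝ} {N : ℕ}
    (h : ∀ R : ℝ, 1 ≤ R → m (Metric.closedBall 0 R) ≤ ENNReal.ofReal (C * R ^ N)) :
    Integrable (fun z : ℂ => Real.exp (-‖z‖)) m := by
  have hm : Measurable fun z : ℂ => Real.exp (-‖z‖) := by fun_prop
  refine ⟨hm.aestronglyMeasurable, ?_⟩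
  have hpt : ∀ z : ℂ, ‖Real.exp (-‖z‖)‖ₑ ≤ ∑' k : ℕ,
      (Metric.closedBall (0 : ℂ) (k + 1)).indicator
        (fun _ => ENNReal.ofReal (Real.exp (-(k : ℝ)))) z := fun z => by
    refine le_trans ?_ (ENNReal.le_tsum ⌊‖z‖⌋₊)
    rw [Set.indicator_of_mem]
    · rw [Real.enorm_eq_ofReal (Real.exp_nonneg _)]
      refine ENNReal.ofReal_le_ofReal (Real.exp_le_exp.2 (neg_le_neg ?_))
      exact Nat.floor_le (norm_nonneg z)
    · rw [mem_closedBall_zero_iff]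
      exact (Nat.lt_floor_add_one _).le
  have hs : Summable fun k : ℕ => Real.exp (-(k : ℝ)) * (|C| * ((k : ℝ) + 1) ^ N) := by
    have h1 := (summable_nat_add_iff 1).2 (Real.summable_pow_mul_exp_neg_nat_mul N one_pos)
    refine (h1.mul_left (|C| * Real.exp 1)).congr fun k => ?_
    have : Real.exp (-1 * ((k + 1 : ℕ) : ℝ)) = Real.exp (-(k : ℝ)) / Real.exp 1 := by
      rw [← Real.exp_sub]; congr 1; push_cast; ring
    rw [this]
    push_cast
    field_simp
  rw [HasFiniteIntegral]
  refine (lintegral_mono hpt).trans_lt ?_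
  rw [lintegral_tsum fun k => (measurable_const.indicator
    Metric.isClosed_closedBall.measurableSet).aemeasurable]
  refine lt_of_le_of_lt (ENNReal.tsum_le_tsum fun k => ?_) hs.tsum_ofReal_lt_top
  rw [lintegral_indicator_const Metric.isClosed_closedBall.measurableSet,
    ENNReal.ofReal_mul (Real.exp_nonneg _)]
  gcongr
  refine (h _ (by simp)).trans (ENNReal.ofReal_le_ofReal ?_)
  gcongr
  exact le_abs_self C

theorem sigmaFinite_of_growth {m : Measure ℂ} {C : ℝ} {N : ℕ}
    (h : ∀ R : ℝ, 1 ≤ R → m (Metric.closedBall 0 R) ≤ ENNReal.ofReal (C * R ^ N)) :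
    SigmaFinite m := by
  have : IsLocallyFiniteMeasure m := ⟨fun z => ⟨Metric.closedBall 0 (‖z‖ + 1),
    Filter.mem_of_superset (Metric.ball_mem_nhds z one_pos) fun w hw => by
      rw [mem_closedBall_zero_iff]
      have h1 := norm_le_norm_add_norm_sub' w z
      have h2 : ‖w - z‖ < 1 := by simpa [dist_eq_norm] using hw
      linarith [norm_sub_rev w z], (h _ (by simp)).trans_lt ENNReal.ofReal_lt_top⟩⟩
  infer_instance

end ArcLength

/-! ### Exponential decay along the contours. -/

section Decay

theorem oddPoly_neg (n : ℕ) (τ : ℕ → ℝ) (z : ℂ) : oddPoly n τ (-z) = -oddPoly n τ z := by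
  have h : ∀ j : ℕ, (-z) ^ (2 * j + 1) = -z ^ (2 * j + 1) := fun j => Odd.neg_pow ⟨j, rfl⟩ z
  simp only [oddPoly, h, mul_neg, Finset.sum_neg_distrib, neg_div]
  ring

theorem continuous_oddPoly (n : ℕ) (τ : ℕ → ℝ) : Continuous (oddPoly n τ) := by
  unfold oddPoly
  fun_prop

theorem asymDir_pow (n : ℕ) : asymDir n ^ (2 * n + 1) = (-1) ^ n := by
  rw [asymDir, ← Complex.exp_nat_mul]
  have h : (2 * (n : ℂ) + 1) ≠ 0 := by exact_mod_cast (by positivity : (2 * (n : ℝ) + 1) ≠ 0)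
  have : ((2 * n + 1 : ℕ) : ℂ) * (((n : ℝ) / (2 * (n : ℝ) + 1) * Real.pi : ℝ) * Complex.I) =
      n * (Real.pi * Complex.I) := by
    push_cast
    field_simp
  rw [this, Complex.exp_nat_mul, Complex.exp_pi_mul_I]

theorem re_asymDir_pos (n : ℕ) : 0 < (asymDir n).re := by
  rw [asymDir, Complex.exp_ofReal_mul_I_re]
  have h : (n : ℝ) / (2 * (n : ℝ) + 1) < 1 / 2 := by
    rw [div_lt_div_iff₀ (by positivity) (by positivity)]; linarith
  have h0 : 0 ≤ (n : ℝ) / (2 * (n : ℝ) + 1) := by positivity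
  refine Real.cos_pos_of_mem_Ioo ⟨?_, ?_⟩ <;> nlinarith [Real.pi_pos]

theorem re_asymDir_inv_pos (n : ℕ) : 0 < (asymDir n)⁻¹.re := by
  rw [Complex.inv_re]
  have h := re_asymDir_pos n
  refine div_pos h (Complex.normSq_pos.2 fun h0 => ?_)
  simp [h0] at h

variable {n : ℕ} {γ : ℝ → ℂ} {u : ℂ} {l : Filter ℝ}

/-- Divide by ‖γ‖^{2n+1}: lower powers drop out and the leading term tends to (-1)^{n+1}
u^{2n+1}/(2n + 1) = -1/(2n + 1). The linear term is of lower order because n ≥ 1. -/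
theorem tendsto_oddPoly_add_atBot (hn : 1 ≤ n) (τ : ℕ → ℝ) (b : ℝ)
    (hu : u ^ (2 * n + 1) = (-1) ^ n) (hγ : Tendsto (fun t => ‖γ t‖) l atTop)
    (hd : Tendsto (fun t => γ t / (‖γ t‖ : ℂ)) l (𝓝 u)) :
    Tendsto (fun t => ((-1) ^ (n + 1) * oddPoly n τ (γ t)).re + b * ‖γ t‖) l atBot := by
  have hinv : Tendsto (fun t => ‖γ t‖⁻¹) l (𝓝 0) := tendsto_inv_atTop_zero.comp hγ
  have hinvC : Tendsto (fun t => ((‖γ t‖⁻¹ : ℝ) : ℂ)) l (𝓝 0) := by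
    have := (Complex.continuous_ofReal.tendsto 0).comp hinv
    rwa [Complex.ofReal_zero] at this
  have h1 : Tendsto (fun t => (-1 : ℂ) ^ (n + 1) *
      ((γ t / (‖γ t‖ : ℂ)) ^ (2 * n + 1) / (2 * (n : ℂ) + 1) +
        ∑ j ∈ Finset.Ico 1 n, (τ j : ℂ) / (2 * (j : ℂ) + 1) *
          ((γ t / (‖γ t‖ : ℂ)) ^ (2 * j + 1) * ((‖γ t‖⁻¹ : ℝ) : ℂ) ^ (2 * n - 2 * j)))) l
      (𝓝 ((-1 : ℂ) ^ (n + 1) * (u ^ (2 * n + 1) / (2 * (n : ℂ) + 1) +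
        ∑ j ∈ Finset.Ico 1 n, (τ j : ℂ) / (2 * (j : ℂ) + 1) *
          (u ^ (2 * j + 1) * 0 ^ (2 * n - 2 * j))))) := by
    refine Tendsto.const_mul _ (((hd.pow _).div_const _).add (tendsto_finsetSum _ fun j _ => ?_))
    exact ((hd.pow _).mul (hinvC.pow _)).const_mul _
  have hlim : (-1 : ℂ) ^ (n + 1) * (u ^ (2 * n + 1) / (2 * (n : ℂ) + 1) +
        ∑ j ∈ Finset.Ico 1 n, (τ j : ℂ) / (2 * (j : ℂ) + 1) *
          (u ^ (2 * j + 1) * 0 ^ (2 * n - 2 * j))) = ((-(1 / (2 * (n : ℝ) + 1)) : ℝ) : ℂ) := by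
    rw [Finset.sum_eq_zero fun j hj => ?_, hu]
    · have : (-1 : ℂ) ^ (n + 1) * (-1) ^ n = -1 := by
        rw [← pow_add, Odd.neg_one_pow ⟨n, by ring⟩]
      rw [add_zero, ← mul_div_assoc, this]
      push_cast
      ring
    · rw [Finset.mem_Ico] at hj
      rw [zero_pow (by omega), mul_zero, mul_zero]
  rw [hlim] at h1
  have h2 := ((Complex.continuous_re.tendsto _).comp h1).add
    ((hinv.pow (2 * n)).const_mul b)
  rw [Complex.ofReal_re, zero_pow (by omega), mul_zero, add_zero] at h2
  have hneg : -(1 / (2 * (n : ℝ) + 1)) < 0 := by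
    rw [neg_lt_zero]; positivity
  have h3 := ((tendsto_pow_atTop (show 2 * n + 1 ≠ 0 by omega)).comp hγ).atTop_mul_neg hneg h2
  refine h3.congr' ?_
  filter_upwards [hγ.eventually_gt_atTop 0] with t ht
  have htC : (‖γ t‖ : ℂ) ≠ 0 := by exact_mod_cast ht.ne'
  have e : (-1 : ℂ) ^ (n + 1) * oddPoly n τ (γ t) = ((‖γ t‖ ^ (2 * n + 1) : ℝ) : ℂ) *
      ((-1 : ℂ) ^ (n + 1) *
      ((γ t / (‖γ t‖ : ℂ)) ^ (2 * n + 1) / (2 * (n : ℂ) + 1) +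
        ∑ j ∈ Finset.Ico 1 n, (τ j : ℂ) / (2 * (j : ℂ) + 1) *
          ((γ t / (‖γ t‖ : ℂ)) ^ (2 * j + 1) * ((‖γ t‖⁻¹ : ℝ) : ℂ) ^ (2 * n - 2 * j)))) := by
    rw [mul_left_comm, oddPoly]
    congr 1
    rw [mul_add, Finset.mul_sum]
    congr 1
    · rw [div_pow]
      push_cast
      field_simp
    · refine Finset.sum_congr rfl fun j hj => ?_
      rw [Finset.mem_Ico] at hj
      have : 2 * n + 1 = (2 * j + 1) + (2 * n - 2 * j) := by omega
      conv_rhs => rw [this]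
      generalize 2 * n - 2 * j = k
      push_cast
      rw [div_pow, pow_add, inv_pow]
      field_simp
      ring
  simp only [Function.comp_apply]
  rw [e, Complex.re_ofReal_mul, mul_add]
  congr 1
  rw [inv_pow, pow_succ]
  field_simp

theorem tendsto_re_atTop (hu : 0 < u.re) (hγ : Tendsto (fun t => ‖γ t‖) l atTop)
    (hd : Tendsto (fun t => γ t / (‖γ t‖ : ℂ)) l (𝓝 u)) :
    Tendsto (fun t => (γ t).re) l atTop := by
  have h := hγ.atTop_mul_pos hu ((Complex.continuous_re.tendsto _).comp hd)
  refine h.congr' ?_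
  filter_upwards [hγ.eventually_gt_atTop 0] with t ht
  simp only [Function.comp_apply, Complex.div_ofReal_re]
  field_simp

/-- Exponential decay along a curve in the right half plane with the asymptotic directions
`asymDir n` and `(asymDir n)⁻¹`. -/
theorem exists_decay (hn : 1 ≤ n) (τ : ℕ → ℝ) (s : ℝ) (hc : Continuous γ)
    (hb : Tendsto (fun t => ‖γ t‖) atBot atTop) (ht : Tendsto (fun t => ‖γ t‖) atTop atTop)
    (hdb : Tendsto (fun t => γ t / (‖γ t‖ : ℂ)) atBot (𝓝 (asymDir n)))
    (hdt : Tendsto (fun t => γ t / (‖γ t‖ : ℂ)) atTop (𝓝 (asymDir n)⁻¹))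
    (hpos : ∀ t, 0 < (γ t).re) :
    ∃ M c : ℝ, 0 < M ∧ 0 < c ∧ (∀ t, c ≤ (γ t).re) ∧ ∀ t r : ℝ, s ≤ r →
      ‖Complex.exp ((-1) ^ (n + 1) / 2 * oddPoly n τ (γ t) - r * γ t)‖ ≤
        M * Real.exp (-‖γ t‖) * Real.exp (-(c * (r - s))) := by
  have hinv : (asymDir n)⁻¹ ^ (2 * n + 1) = (-1) ^ n := by
    rw [inv_pow, asymDir_pow, ← inv_pow, inv_neg, inv_one]
  -- This function tends to -∞ at both ends, so its maximum B exists. The weights contain p/2, so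
  -- only half of B is used; half of 2(1 + |s|)‖γ‖ pays for e^{-‖γ‖} and for -s Re γ.
  obtain ⟨t₀, ht₀⟩ := Continuous.exists_forall_ge
    (f := fun t => ((-1) ^ (n + 1) * oddPoly n τ (γ t)).re + 2 * (1 + |s|) * ‖γ t‖)
    (by have := continuous_oddPoly n τ; fun_prop) (by
      rw [cocompact_eq_atBot_atTop]
      exact (tendsto_oddPoly_add_atBot hn τ _ (asymDir_pow n) hb hdb).sup
        (tendsto_oddPoly_add_atBot hn τ _ hinv ht hdt))
  -- The constant c is the minimum of Re γ, attained because Re γ → ∞ at both ends.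
  obtain ⟨t₁, ht₁⟩ := Continuous.exists_forall_le (f := fun t => (γ t).re) (by fun_prop) (by
      rw [cocompact_eq_atBot_atTop]
      exact (tendsto_re_atTop (re_asymDir_pos n) hb hdb).sup
        (tendsto_re_atTop (re_asymDir_inv_pos n) ht hdt))
  set B := ((-1) ^ (n + 1) * oddPoly n τ (γ t₀)).re + 2 * (1 + |s|) * ‖γ t₀‖
  refine ⟨Real.exp (B / 2), (γ t₁).re, Real.exp_pos _, hpos _, ht₁, fun t r hr => ?_⟩
  rw [Complex.norm_exp, ← Real.exp_add, ← Real.exp_add, Real.exp_le_exp]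
  have h1 := ht₀ t
  have h2 := ht₁ t
  have e : ((-1) ^ (n + 1) / 2 * oddPoly n τ (γ t) - r * γ t).re =
      ((-1) ^ (n + 1) * oddPoly n τ (γ t)).re / 2 - r * (γ t).re := by
    rw [Complex.sub_re, Complex.re_ofReal_mul, div_mul_eq_mul_div]
    congr 1
    exact Complex.div_ofNat_re _ 2
  have h3 : -(s * (γ t).re) ≤ |s| * ‖γ t‖ := by
    refine (neg_le_abs _).trans ?_
    rw [abs_mul]
    gcongr
    exact Complex.abs_re_le_norm _
  have h4 : (γ t₁).re * (r - s) ≤ (γ t).re * (r - s) :=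
    mul_le_mul_of_nonneg_right h2 (by linarith)
  rw [e]
  linarith

end Decay

/-! ### Measurability and product bounds for composed kernels. -/

section CompositionBound

variable {W X Y : Type*} [MeasurableSpace X] [MeasurableSpace Y]

theorem measurable_uncurry_comp [MeasurableSpace W] {μ : Measure X} {ν : Measure Y} [SigmaFinite μ] [SigmaFinite ν]
    {D : W → X → ℂ} {A : X → Y → ℂ} {C : Y → W → ℂ}
    (hD : Measurable (Function.uncurry D)) (hA : Measurable (Function.uncurry A))
    (hC : Measurable (Function.uncurry C)) :
    Measurable (Function.uncurry fun t t' => ∫ x, D t x * ∫ y, A x y * C y t' ∂ν ∂μ) := by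
  have h1 : Measurable fun q : X × W => ∫ y, A q.1 y * C y q.2 ∂ν := by
    refine (StronglyMeasurable.integral_prod_right (f := fun (q : X × W) y => A q.1 y * C y q.2)
      (Measurable.stronglyMeasurable ?_)).measurable
    exact (hA.comp (f := fun w : (X × W) × Y => (w.1.1, w.2)) (by fun_prop)).mul
      (hC.comp (f := fun w : (X × W) × Y => (w.2, w.1.2)) (by fun_prop))
  refine (StronglyMeasurable.integral_prod_right
    (f := fun (q : W × W) x => D q.1 x * ∫ y, A x y * C y q.2 ∂ν)
    (Measurable.stronglyMeasurable ?_)).measurable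
  exact (hD.comp (f := fun w : (W × W) × X => (w.1.1, w.2)) (by fun_prop)).mul
    (h1.comp (f := fun w : (W × W) × X => (w.2, w.1.2)) (by fun_prop))

theorem norm_comp_le {μ : Measure X} {ν : Measure Y} {S : Set W}
    {D : W → X → ℂ} {A : X → Y → ℂ} {C : Y → W → ℂ}
    {d : W → ℝ} {α : X → ℝ} {β : Y → ℝ} (hd0 : ∀ t, 0 ≤ d t) (hα0 : ∀ x, 0 ≤ α x)
    (hβ0 : ∀ y, 0 ≤ β y)
    (hα : Integrable (fun x => α x * α x) μ) (hβ : Integrable (fun y => β y * β y) ν)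
    (hDb : ∀ t ∈ S, ∀ x, ‖D t x‖ ≤ d t * α x) (hAb : ∀ x y, ‖A x y‖ ≤ α x * β y)
    (hCb : ∀ t ∈ S, ∀ y, ‖C y t‖ ≤ β y * d t) :
    ∀ t ∈ S, ∀ t' ∈ S, ‖∫ x, D t x * ∫ y, A x y * C y t' ∂ν ∂μ‖ ≤
      (d t * ((∫ x, α x * α x ∂μ) * ∫ y, β y * β y ∂ν)) * d t' := fun t ht t' ht' => by
  have b : ∀ x, ‖∫ y, A x y * C y t' ∂ν‖ ≤ α x * d t' * ∫ y, β y * β y ∂ν := fun x => by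
    rw [← integral_const_mul]
    refine norm_integral_le_of_norm_le (hβ.const_mul _) (.of_forall fun y => ?_)
    rw [norm_mul]
    calc ‖A x y‖ * ‖C y t'‖ ≤ (α x * β y) * (β y * d t') := by
          gcongr
          · exact mul_nonneg (hα0 x) (hβ0 y)
          · exact hAb x y
          · exact hCb t' ht' y
      _ = _ := by ring
  have e : (d t * ((∫ x, α x * α x ∂μ) * ∫ y, β y * β y ∂ν)) * d t' =
      ∫ x, (d t * d t' * ∫ y, β y * β y ∂ν) * (α x * α x) ∂μ := by
    rw [integral_const_mul]; ring
  rw [e]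
  refine norm_integral_le_of_norm_le (hα.const_mul _) (.of_forall fun x => ?_)
  rw [norm_mul]
  calc ‖D t x‖ * ‖∫ y, A x y * C y t' ∂ν‖
      ≤ (d t * α x) * (α x * d t' * ∫ y, β y * β y ∂ν) := by
        gcongr
        · exact mul_nonneg (hd0 t) (hα0 x)
        · exact hDb t ht x
        · exact b x
    _ = _ := by ring

end CompositionBound

/-! ### Cauchy kernels with weights supported in half planes. -/

section WeightedCauchy

variable {φ ψ : ℂ → ℂ} {c : ℝ}

/-- Apply the expansion of 1/(x + y) at x and -y. Off the half planes a weight vanishes and both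
sides are zero, so no restriction on x and y is needed, not even x ≠ y. -/
theorem hasSum_weighted_cauchy (hφ : ∀ z, φ z ≠ 0 → 0 < z.re) (hψ : ∀ z, ψ z ≠ 0 → 0 < (-z).re)
    (x y : ℂ) : HasSum (fun i => (φ x * cauchyFun i x) * (2 * ψ y * cauchyFun i (-y)))
      (φ x * ψ y / (x - y)) := by
  by_cases hx : φ x = 0
  · simp [hx]
  by_cases hy : ψ y = 0
  · simp [hy]
  have h := (hasSum_cauchyFun_mul (hφ x hx) (hψ y hy)).mul_left (φ x * ψ y)
  rw [mul_one_div, ← sub_eq_add_neg] at h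
  refine h.congr_fun fun i => ?_
  ring

theorem sum_norm_mul_cauchyFun_sq_le (hc : 0 < c) {a w : ℂ} (h : a ≠ 0 → c ≤ w.re)
    (u : Finset ℕ) : ∑ i ∈ u, ‖a * cauchyFun i w‖ ^ 2 ≤ ‖a‖ ^ 2 / (4 * c) := by
  by_cases ha : a = 0
  · simp [ha]
  have hs := hasSum_norm_cauchyFun_sq (hc.trans_le (h ha))
  simp only [norm_mul, mul_pow, ← Finset.mul_sum]
  rw [div_eq_mul_one_div]
  gcongr
  calc ∑ i ∈ u, ‖cauchyFun i w‖ ^ 2 ≤ 1 / (4 * w.re) :=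
        sum_le_hasSum u (fun i _ => sq_nonneg _) hs
    _ ≤ 1 / (4 * c) := by
        have := h ha
        gcongr

theorem norm_weighted_cauchy_le (hc : 0 < c) {a b x y : ℂ} (hx : a ≠ 0 → c ≤ x.re)
    (hy : b ≠ 0 → c ≤ (-y).re) : ‖a * b / (x - y)‖ ≤ ‖a‖ * ‖b‖ / (2 * c) := by
  by_cases ha : a = 0
  · simp [ha]
  by_cases hb : b = 0
  · simp [hb]
  rw [norm_div, norm_mul]
  have h : 2 * c ≤ ‖x - y‖ := by
    refine le_trans ?_ (Complex.re_le_norm _)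
    have h1 := hx ha
    have h2 := hy hb
    rw [Complex.neg_re] at h2
    rw [Complex.sub_re]
    linarith
  gcongr

end WeightedCauchy

/-! ### The exponential weights and the factorizations of both kernels. -/

section Weights

variable {n : ℕ} {τ : ℕ → ℝ} {γ γL γR : ℝ → ℂ}

/-- `e^{(-1)^{n+1} p(z) / 2 - r z}` on `γ`. -/
def weightR (n : ℕ) (τ : ℕ → ℝ) (γ : ℝ → ℂ) (r : ℝ) (z : ℂ) : ℂ :=
  Complex.exp ((-1) ^ (n + 1) / 2 * oddPoly n τ z - r * z) * curveInd γ z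

/-- `e^{(-1)^n p(z) / 2 + r z}` on `γ`. -/
def weightL (n : ℕ) (τ : ℕ → ℝ) (γ : ℝ → ℂ) (r : ℝ) (z : ℂ) : ℂ :=
  Complex.exp ((-1) ^ n / 2 * oddPoly n τ z + r * z) * curveInd γ z

theorem mem_range_of_weightR_ne_zero {r : ℝ} {z : ℂ} (h : weightR n τ γ r z ≠ 0) :
    z ∈ Set.range γ := by
  by_contra hz
  exact h (by rw [weightR, curveInd_of_notMem hz, mul_zero])

theorem mem_range_of_weightL_ne_zero {r : ℝ} {z : ℂ} (h : weightL n τ γ r z ≠ 0) :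
    z ∈ Set.range γ := by
  by_contra hz
  exact h (by rw [weightL, curveInd_of_notMem hz, mul_zero])

theorem measurable_weightR (hc : Continuous γ) (hi : Function.Injective γ) :
    Measurable fun q : ℝ × ℂ => weightR n τ γ q.1 q.2 := by
  have h1 := (continuous_oddPoly n τ).measurable
  have h2 := measurable_curveInd hc hi
  unfold weightR
  fun_prop

theorem measurable_weightL (hc : Continuous γ) (hi : Function.Injective γ) :
    Measurable fun q : ℝ × ℂ => weightL n τ γ q.1 q.2 := by
  have h1 := (continuous_oddPoly n τ).measurable
  have h2 := measurable_curveInd hc hi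
  unfold weightL
  fun_prop

theorem IsContour.continuous {u v : ℂ} (h : IsContour γ u v) : Continuous γ :=
  h.locallyLipschitz.continuous

theorem exists_weightR_bound (hn : 1 ≤ n) (τ : ℕ → ℝ) (hR : IsRightContour n γ) (s : ℝ) :
    ∃ M c : ℝ, 0 < M ∧ 0 < c ∧ (∀ z ∈ Set.range γ, c ≤ z.re) ∧ ∀ r, s ≤ r → ∀ z,
      ‖weightR n τ γ r z‖ ≤ M * Real.exp (-‖z‖) * Real.exp (-(c * (r - s))) := by
  obtain ⟨M, c, hM, hc, h1, h2⟩ := exists_decay hn τ s hR.1.continuous hR.1.norm_atBot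
    hR.1.norm_atTop hR.1.dir_atBot hR.1.dir_atTop hR.2
  refine ⟨M, c, hM, hc, by rintro _ ⟨t, rfl⟩; exact h1 t, fun r hr z => ?_⟩
  by_cases hz : z ∈ Set.range γ
  · obtain ⟨t, rfl⟩ := hz
    rw [weightR, curveInd_apply, mul_one]
    exact h2 t r hr
  · rw [weightR, curveInd_of_notMem hz, mul_zero, norm_zero]
    positivity

/-- As p is odd, z ↦ -z carries the weight on γL to the weight on the reflected curve, which has the
directions required in `exists_decay`. -/
theorem exists_weightL_bound (hn : 1 ≤ n) (τ : ℕ → ℝ) (hL : IsLeftContour n γ) (s : ℝ) :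
    ∃ M c : ℝ, 0 < M ∧ 0 < c ∧ (∀ z ∈ Set.range γ, c ≤ (-z).re) ∧ ∀ r, s ≤ r → ∀ z,
      ‖weightL n τ γ r z‖ ≤ M * Real.exp (-‖z‖) * Real.exp (-(c * (r - s))) := by
  obtain ⟨M, c, hM, hc, h1, h2⟩ := exists_decay (γ := fun t => -γ t) hn τ s
    hL.1.continuous.neg (by simpa using hL.1.norm_atBot) (by simpa using hL.1.norm_atTop)
    (by simpa [neg_div] using hL.1.dir_atBot.neg) (by simpa [neg_div] using hL.1.dir_atTop.neg)
    (fun t => by simpa using hL.2 t)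
  refine ⟨M, c, hM, hc, by rintro _ ⟨t, rfl⟩; exact h1 t, fun r hr z => ?_⟩
  by_cases hz : z ∈ Set.range γ
  · obtain ⟨t, rfl⟩ := hz
    rw [weightL, curveInd_apply, mul_one]
    have := h2 t r hr
    rw [oddPoly_neg, norm_neg] at this
    convert this using 3
    ring
  · rw [weightL, curveInd_of_notMem hz, mul_zero, norm_zero]
    positivity

theorem exists_weight_bounds (hn : 1 ≤ n) (τ : ℕ → ℝ) (hL : IsLeftContour n γL)
    (hR : IsRightContour n γR) (s : ℝ) : ∃ M c : ℝ, 0 < M ∧ 0 < c ∧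
      (∀ z ∈ Set.range γR, c ≤ z.re) ∧ (∀ z ∈ Set.range γL, c ≤ (-z).re) ∧
      (∀ z, ‖weightR n τ γR 0 z‖ ≤ M * Real.exp (-‖z‖)) ∧
      (∀ z, ‖weightL n τ γL 0 z‖ ≤ M * Real.exp (-‖z‖)) ∧
      (∀ r, s ≤ r → ∀ z,
        ‖weightR n τ γR r z‖ ≤ M * Real.exp (-‖z‖) * Real.exp (-(c * (r - s)))) ∧
      (∀ r, s ≤ r → ∀ z,
        ‖weightL n τ γL r z‖ ≤ M * Real.exp (-‖z‖) * Real.exp (-(c * (r - s)))) := by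
  -- The exponent r = 0 may lie below s, so it gets its own bounds with threshold 0.
  obtain ⟨M₁, c₁, hM₁, hc₁, a₁, b₁⟩ := exists_weightR_bound hn τ hR 0
  obtain ⟨M₂, c₂, hM₂, hc₂, a₂, b₂⟩ := exists_weightL_bound hn τ hL 0
  obtain ⟨M₃, c₃, hM₃, hc₃, a₃, b₃⟩ := exists_weightR_bound hn τ hR s
  obtain ⟨M₄, c₄, hM₄, hc₄, a₄, b₄⟩ := exists_weightL_bound hn τ hL s
  have le₃ : min c₃ c₄ ≤ c₃ := min_le_left _ _
  have le₄ : min c₃ c₄ ≤ c₄ := min_le_right _ _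
  refine ⟨M₁ + M₂ + M₃ + M₄, min c₃ c₄, by positivity, lt_min hc₃ hc₄,
    fun z hz => le₃.trans (a₃ z hz), fun z hz => le₄.trans (a₄ z hz),
    fun z => ?_, fun z => ?_, fun r hr z => (b₃ r hr z).trans ?_, fun r hr z => (b₄ r hr z).trans ?_⟩
  · have := b₁ 0 le_rfl z
    rw [sub_self, mul_zero, neg_zero, Real.exp_zero, mul_one] at this
    refine this.trans ?_
    gcongr
    linarith
  · have := b₂ 0 le_rfl z
    rw [sub_self, mul_zero, neg_zero, Real.exp_zero, mul_one] at this
    refine this.trans ?_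
    gcongr
    linarith
  · have : 0 ≤ r - s := by linarith
    gcongr
    linarith
  · have : 0 ≤ r - s := by linarith
    gcongr
    linarith

/-- The restriction of `kernelLArc` to `γR × γL`. -/
def kernelRL (n : ℕ) (τ : ℕ → ℝ) (γL γR : ℝ → ℂ) (l μ : ℂ) : ℂ :=
  (1 / (2 * Real.pi * Complex.I) * weightR n τ γR 0 l) *
    (weightL n τ γL 0 μ * unitTangent γL μ) / (l - μ)

/-- The restriction of `kernelLArc` to `γL × γR`. -/
def kernelLR (n : ℕ) (τ : ℕ → ℝ) (γL γR : ℝ → ℂ) (s : ℝ) (l μ : ℂ) : ℂ :=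
  (weightR n τ γR s μ * unitTangent γR μ) *
    (-(1 / (2 * Real.pi * Complex.I)) * weightL n τ γL s l) / (μ - l)

theorem vecF_zero (s : ℝ) (z : ℂ) :
    vecF n τ γL γR s z 0 = 1 / (2 * Real.pi * Complex.I) * weightR n τ γR 0 z := by
  simp [vecF, weightR]

theorem vecF_one (s : ℝ) (z : ℂ) :
    vecF n τ γL γR s z 1 = 1 / (2 * Real.pi * Complex.I) * weightL n τ γL s z := by
  simp [vecF, weightL]

theorem vecG_zero (s : ℝ) (z : ℂ) : vecG n τ γL γR s z 0 = weightL n τ γL 0 z := by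
  simp [vecG, weightL]

theorem vecG_one (s : ℝ) (z : ℂ) : vecG n τ γL γR s z 1 = weightR n τ γR s z := by
  simp [vecG, weightR]

theorem disjoint_range (hL : IsLeftContour n γL) (hR : IsRightContour n γR) {z : ℂ}
    (h : z ∈ Set.range γR) : z ∉ Set.range γL := by
  obtain ⟨t, rfl⟩ := h
  rintro ⟨t', h⟩
  have h1 := hL.2 t'
  rw [h] at h1
  exact lt_asymm h1 (hR.2 t)

/-- Each weight annihilates the tangent of the other curve, which removes the cross terms. -/
theorem kernelLArc_eq (hL : IsLeftContour n γL) (hR : IsRightContour n γR) (s : ℝ) :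
    kernelLArc n τ γL γR s =
      fun l μ => kernelRL n τ γL γR l μ + kernelLR n τ γL γR s l μ := by
  funext l μ
  have h1 : weightL n τ γL 0 μ * unitTangent γR μ = 0 := by
    by_cases h : μ ∈ Set.range γR
    · rw [weightL, curveInd_of_notMem (disjoint_range hL hR h), mul_zero, zero_mul]
    · rw [unitTangent_of_notMem h, mul_zero]
  have h2 : weightR n τ γR s μ * unitTangent γL μ = 0 := by
    by_cases h : μ ∈ Set.range γR
    · rw [unitTangent_of_notMem (disjoint_range hL hR h), mul_zero]
    · rw [weightR, curveInd_of_notMem h, mul_zero, zero_mul]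
  have h3 : μ - l = -(l - μ) := by ring
  rw [kernelLArc, kernelL, dotProduct, Fin.sum_univ_two, vecF_zero, vecF_one, vecG_zero, vecG_one,
    kernelRL, kernelLR, h3, div_neg, ← neg_div, ← add_div, div_mul_eq_mul_div]
  congr 1
  linear_combination (1 / (2 * Real.pi * Complex.I) * weightR n τ γR 0 l) * h1 +
    (1 / (2 * Real.pi * Complex.I) * weightL n τ γL s l) * h2

theorem vecF_dotProduct_vecG (hL : IsLeftContour n γL) (hR : IsRightContour n γR) (s : ℝ) (z : ℂ) :
    vecF n τ γL γR s z ⬝ᵥ vecG n τ γL γR s z = 0 := by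
  rw [dotProduct, Fin.sum_univ_two, vecF_zero, vecF_one, vecG_zero, vecG_one]
  by_cases h : z ∈ Set.range γR
  · simp [weightL, curveInd_of_notMem (disjoint_range hL hR h)]
  · simp [weightR, curveInd_of_notMem h]

theorem neg_one_pow_succ_eq (n : ℕ) : (-1 : ℂ) ^ (n + 1) = -(-1) ^ n := by rw [pow_succ]; ring

/-- This is K = DAC: one half of each exponent p, free of t, goes to A, the other half to D or C.
The minus sign in C comes from λ - μ = -(μ - λ). -/
theorem airyKernel_eq (cL : Continuous γL) (iL : Function.Injective γL)
    (cR : Continuous γR) (iR : Function.Injective γR) :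
    airyKernel n τ γL γR = fun t t' => ∫ x, (weightR n τ γR t x * unitTangent γR x) *
      ∫ y, kernelRL n τ γL γR x y * (-(1 / (2 * Real.pi * Complex.I)) * weightL n τ γL t' y)
        ∂(arcLength γL) ∂(arcLength γR) := by
  funext t t'
  rw [airyKernel, contourIntegral_eq cR iR, ← integral_const_mul]
  refine integral_congr_ae (.of_forall fun x => ?_)
  simp only
  by_cases hx : x ∈ Set.range γR
  swap
  · simp [unitTangent_of_notMem hx]
  rw [contourIntegral_eq cL iL, ← integral_mul_const, ← integral_const_mul, ← integral_const_mul]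
  refine integral_congr_ae (.of_forall fun y => ?_)
  simp only
  by_cases hy : y ∈ Set.range γL
  swap
  · simp [kernelRL, unitTangent_of_notMem hy]
  have iy : curveInd γL y = 1 := by obtain ⟨t, rfl⟩ := hy; exact curveInd_apply t
  have ix : curveInd γR x = 1 := by obtain ⟨t, rfl⟩ := hx; exact curveInd_apply t
  have he : Complex.exp ((-1) ^ (n + 1) * (oddPoly n τ x - oddPoly n τ y) - t * x + t' * y) =
      Complex.exp ((-1) ^ (n + 1) / 2 * oddPoly n τ x - t * x) *
      Complex.exp ((-1) ^ (n + 1) / 2 * oddPoly n τ x - (0 : ℝ) * x) *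
      (Complex.exp ((-1) ^ n / 2 * oddPoly n τ y + (0 : ℝ) * y) *
        Complex.exp ((-1) ^ n / 2 * oddPoly n τ y + t' * y)) := by
    rw [← Complex.exp_add, ← Complex.exp_add, ← Complex.exp_add, neg_one_pow_succ_eq]
    congr 1
    push_cast
    ring
  rw [airyIntegrand, he, kernelRL, weightR, weightR, weightL, weightL, ix, iy,
    show y - x = -(x - y) by ring, div_neg]
  ring

/-- The factorization B = CD: e^{(y-x)s}/(x - y) is the integral of e^{(y-x)t} over [s, ∞),
convergent since Re(y - x) < 0. -/
theorem kernelLR_eq (hL : IsLeftContour n γL) (hR : IsRightContour n γR) (s : ℝ) (x y : ℂ) :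
    kernelLR n τ γL γR s y x = ∫ t in Set.Ici s, (-(1 / (2 * Real.pi * Complex.I)) *
      weightL n τ γL t y) * (weightR n τ γR t x * unitTangent γR x) := by
  by_cases hx : x ∈ Set.range γR
  swap
  · simp [kernelLR, unitTangent_of_notMem hx]
  by_cases hy : y ∈ Set.range γL
  swap
  · simp [kernelLR, weightL, curveInd_of_notMem hy]
  have iy : curveInd γL y = 1 := by obtain ⟨t, rfl⟩ := hy; exact curveInd_apply t
  have ix : curveInd γR x = 1 := by obtain ⟨t, rfl⟩ := hx; exact curveInd_apply t
  have hre : (y - x).re < 0 := by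
    obtain ⟨t, rfl⟩ := hx
    obtain ⟨t', rfl⟩ := hy
    have h1 := hL.2 t'
    have h2 := hR.2 t
    rw [Complex.sub_re]
    linarith
  have he : ∀ t : ℝ, (-(1 / (2 * Real.pi * Complex.I)) *
      weightL n τ γL t y) * (weightR n τ γR t x * unitTangent γR x) =
      (-(1 / (2 * Real.pi * Complex.I)) * unitTangent γR x *
        Complex.exp ((-1) ^ n / 2 * (oddPoly n τ y - oddPoly n τ x))) *
          Complex.exp ((y - x) * t) := fun t => by
    have : Complex.exp ((-1) ^ n / 2 * (oddPoly n τ y - oddPoly n τ x)) *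
        Complex.exp ((y - x) * t) = Complex.exp ((-1) ^ n / 2 * oddPoly n τ y + t * y) *
          Complex.exp ((-1) ^ (n + 1) / 2 * oddPoly n τ x - t * x) := by
      rw [← Complex.exp_add, ← Complex.exp_add, neg_one_pow_succ_eq]
      congr 1
      ring
    rw [weightL, weightR, ix, iy]
    linear_combination (1 / (2 * Real.pi * Complex.I) * unitTangent γR x) * this
  have hs : Complex.exp ((-1) ^ n / 2 * (oddPoly n τ y - oddPoly n τ x)) *
      Complex.exp ((y - x) * s) = Complex.exp ((-1) ^ n / 2 * oddPoly n τ y + s * y) *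
          Complex.exp ((-1) ^ (n + 1) / 2 * oddPoly n τ x - s * x) := by
    rw [← Complex.exp_add, ← Complex.exp_add, neg_one_pow_succ_eq]
    congr 1
    ring
  simp only [he]
  rw [integral_const_mul, integral_Ici_eq_integral_Ioi, integral_exp_mul_complex_Ioi hre, kernelLR,
    weightL, weightR, ix, iy, show x - y = -(y - x) by ring, div_neg]
  linear_combination (-(1 / (2 * Real.pi * Complex.I)) * unitTangent γR x / (y - x)) * hs

end Weights

/-! ### The determinant identity for abstract pairs of weights. -/

section CauchyPair

/-- Weight functions `φ, D` in the right half plane and `ψ, C` in the left half plane, bounded by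
`M e^{-‖z‖}` and linked by a Laplace transform on `[s, ∞)`. -/
structure CauchyPair (mR mL : Measure ℂ) (s c M : ℝ) (φ ψ : ℂ → ℂ) (D : ℝ → ℂ → ℂ)
    (C : ℂ → ℝ → ℂ) : Prop where
  c_pos : 0 < c
  M_pos : 0 < M
  integrableR : Integrable (fun z => Real.exp (-‖z‖)) mR
  integrableL : Integrable (fun z => Real.exp (-‖z‖)) mL
  aeR : ∀ᵐ z ∂mR, c ≤ z.re
  aeL : ∀ᵐ z ∂mL, c ≤ (-z).re
  measurable_φ : Measurable φ
  measurable_ψ : Measurable ψ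
  measurable_D : Measurable (Function.uncurry D)
  measurable_C : Measurable (Function.uncurry C)
  re_φ : ∀ z, φ z ≠ 0 → c ≤ z.re
  re_ψ : ∀ z, ψ z ≠ 0 → c ≤ (-z).re
  re_D : ∀ z, D s z ≠ 0 → c ≤ z.re
  re_C : ∀ z, C z s ≠ 0 → c ≤ (-z).re
  norm_φ : ∀ z, ‖φ z‖ ≤ M * Real.exp (-‖z‖)
  norm_ψ : ∀ z, ‖ψ z‖ ≤ M * Real.exp (-‖z‖)
  norm_D : ∀ t ∈ Set.Ici s, ∀ z, ‖D t z‖ ≤ M * Real.exp (-‖z‖) * Real.exp (-(c * (t - s)))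
  norm_C : ∀ t ∈ Set.Ici s, ∀ z, ‖C z t‖ ≤ M * Real.exp (-‖z‖) * Real.exp (-(c * (t - s)))
  laplace : ∀ x y, D s x * C y s / (x - y) = ∫ t in Set.Ici s, C y t * D t x

/-- An envelope that dominates the weights and, by its square, the Cauchy kernels with weights. -/
def envelope (M c : ℝ) (z : ℂ) : ℝ := M * (1 + 1 / c) * Real.exp (-‖z‖)

variable {M c : ℝ}

theorem envelope_nonneg (hM : 0 < M) (hc : 0 < c) (z : ℂ) : 0 ≤ envelope M c z := by
  unfold envelope
  positivity

theorem le_envelope (hM : 0 < M) (hc : 0 < c) (z : ℂ) : M * Real.exp (-‖z‖) ≤ envelope M c z := by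
  refine mul_le_mul_of_nonneg_right (le_mul_of_one_le_right hM.le ?_) (Real.exp_pos _).le
  have := one_div_pos.2 hc
  linarith

/-- The factor 1 + 1/c is chosen because its square exceeds 1/c and it exceeds 1: one envelope
serves for weights and kernels. -/
theorem mul_div_le_envelope (hM : 0 < M) (hc : 0 < c) (x y : ℂ) :
    M * Real.exp (-‖x‖) * (M * Real.exp (-‖y‖)) / c ≤ envelope M c x * envelope M c y := by
  have h : envelope M c x * envelope M c y =
      M * Real.exp (-‖x‖) * (M * Real.exp (-‖y‖)) / c +
        M ^ 2 * (1 + 1 / c + 1 / c ^ 2) * (Real.exp (-‖x‖) * Real.exp (-‖y‖)) := by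
    unfold envelope
    field_simp
    ring
  rw [h]
  exact le_add_of_nonneg_right (by positivity)

theorem integrable_envelope_sq {m : Measure ℂ} (hm : Integrable (fun z => Real.exp (-‖z‖)) m) :
    Integrable (fun z => envelope M c z ^ 2) m := by
  unfold envelope
  refine (hm.const_mul ((M * (1 + 1 / c)) ^ 2)).mono' (by fun_prop) (.of_forall fun z => ?_)
  rw [Real.norm_of_nonneg (sq_nonneg _), mul_pow]
  gcongr
  exact pow_le_of_le_one (Real.exp_pos _).le (by simp) two_ne_zero

theorem integrable_exp_sq (hc : 0 < c) (s : ℝ) :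
    Integrable (fun t => Real.exp (-(c * (t - s))) ^ 2) (volume.restrict (Set.Ici s)) := by
  have h := (((integrableOn_Ici_iff_integrableOn_Ioi (by finiteness)).2
    (exp_neg_integrableOn_Ioi s (show 0 < 2 * c by linarith))).const_mul (Real.exp (2 * c * s)))
  refine h.congr (.of_forall fun t => ?_)
  simp only
  rw [← Real.exp_add, ← Real.exp_nat_mul]
  congr 1
  push_cast
  ring

theorem sum_norm_mul_cauchyFun_sq_le_envelope (hM : 0 < M) (hc : 0 < c) {a z w : ℂ}
    (ha : ‖a‖ ≤ M * Real.exp (-‖z‖)) (hw : a ≠ 0 → c ≤ w.re) (u : Finset ℕ) :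
    ∑ i ∈ u, ‖a * cauchyFun i w‖ ^ 2 ≤ envelope M c z ^ 2 / 4 := by
  refine (sum_norm_mul_cauchyFun_sq_le hc hw u).trans ?_
  have h1 : ‖a‖ ^ 2 ≤ (M * Real.exp (-‖z‖)) ^ 2 := pow_le_pow_left₀ (norm_nonneg _) ha 2
  have h2 := div_le_div_of_nonneg_right h1 hc.le
  have h3 : ‖a‖ ^ 2 / (4 * c) = ‖a‖ ^ 2 / c / 4 := by field_simp
  have h4 := mul_div_le_envelope hM hc z z
  rw [← sq, ← sq] at h4
  rw [h3]
  linarith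

theorem sum_norm_mul_cauchyFun_sq_le_envelope' (hM : 0 < M) (hc : 0 < c) {a z w : ℂ}
    (ha : ‖a‖ ≤ M * Real.exp (-‖z‖)) (hw : a ≠ 0 → c ≤ w.re) (u : Finset ℕ) :
    ∑ i ∈ u, ‖a * cauchyFun i w‖ ^ 2 ≤ envelope M c z ^ 2 :=
  (sum_norm_mul_cauchyFun_sq_le_envelope hM hc ha hw u).trans
    (by linarith [sq_nonneg (envelope M c z)])

theorem sum_norm_two_mul_cauchyFun_sq_le_envelope (hM : 0 < M) (hc : 0 < c) {a z w : ℂ}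
    (ha : ‖a‖ ≤ M * Real.exp (-‖z‖)) (hw : a ≠ 0 → c ≤ w.re) (u : Finset ℕ) :
    ∑ i ∈ u, ‖2 * a * cauchyFun i w‖ ^ 2 ≤ envelope M c z ^ 2 := by
  have h := sum_norm_mul_cauchyFun_sq_le_envelope hM hc ha hw u
  have h2 : ∀ i, ‖2 * a * cauchyFun i w‖ ^ 2 = 4 * ‖a * cauchyFun i w‖ ^ 2 :=
    fun i => by rw [mul_assoc, norm_mul, mul_pow, Complex.norm_ofNat]; norm_num
  simp only [h2, ← Finset.mul_sum]
  linarith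

/-- The half comes from Re(x - y) ≥ 2c; thanks to it, the sum of both off-diagonal kernels is still
below a single product of envelopes. -/
theorem norm_cauchy_le_envelope (hM : 0 < M) (hc : 0 < c) {a b x y : ℂ}
    (ha : ‖a‖ ≤ M * Real.exp (-‖x‖)) (hb : ‖b‖ ≤ M * Real.exp (-‖y‖))
    (hx : a ≠ 0 → c ≤ x.re) (hy : b ≠ 0 → c ≤ (-y).re) :
    ‖a * b / (x - y)‖ ≤ envelope M c x * envelope M c y / 2 := by
  have h := mul_div_le_envelope hM hc x y
  calc ‖a * b / (x - y)‖ ≤ ‖a‖ * ‖b‖ / (2 * c) := norm_weighted_cauchy_le hc hx hy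
    _ ≤ M * Real.exp (-‖x‖) * (M * Real.exp (-‖y‖)) / (2 * c) := by gcongr
    _ = M * Real.exp (-‖x‖) * (M * Real.exp (-‖y‖)) / c / 2 := by field_simp
    _ ≤ _ := by linarith

theorem measurable_mul_cauchyFun {f : ℂ → ℂ} (hf : Measurable f) (i : ℕ) :
    Measurable fun z => f z * cauchyFun i z :=
  hf.mul (measurable_cauchyFun i)

theorem measurable_mul_cauchyFun_neg {f : ℂ → ℂ} (hf : Measurable f) (i : ℕ) :
    Measurable fun z => 2 * f z * cauchyFun i (-z) :=
  (hf.const_mul 2).mul ((measurable_cauchyFun i).comp measurable_neg)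

namespace CauchyPair

variable {mR mL : Measure ℂ} {s : ℝ} {φ ψ : ℂ → ℂ} {D : ℝ → ℂ → ℂ} {C : ℂ → ℝ → ℂ}

theorem norm_D_self (h : CauchyPair mR mL s c M φ ψ D C) (z : ℂ) :
    ‖D s z‖ ≤ M * Real.exp (-‖z‖) := by
  simpa using h.norm_D s Set.self_mem_Ici z

theorem norm_C_self (h : CauchyPair mR mL s c M φ ψ D C) (z : ℂ) :
    ‖C z s‖ ≤ M * Real.exp (-‖z‖) := by
  simpa using h.norm_C s Set.self_mem_Ici z

theorem measurable_D_self (h : CauchyPair mR mL s c M φ ψ D C) : Measurable (D s) :=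
  h.measurable_D.comp measurable_prodMk_left

theorem measurable_C_self (h : CauchyPair mR mL s c M φ ψ D C) : Measurable fun z => C z s :=
  h.measurable_C.comp measurable_prodMk_right

theorem norm_D_le_envelope (h : CauchyPair mR mL s c M φ ψ D C) :
    ∀ t ∈ Set.Ici s, ∀ z, ‖D t z‖ ≤ Real.exp (-(c * (t - s))) * envelope M c z := fun t ht z => by
  rw [mul_comm]
  refine (h.norm_D t ht z).trans ?_
  gcongr
  exact le_envelope h.M_pos h.c_pos z

theorem norm_C_le_envelope (h : CauchyPair mR mL s c M φ ψ D C) :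
    ∀ t ∈ Set.Ici s, ∀ z, ‖C z t‖ ≤ envelope M c z * Real.exp (-(c * (t - s))) := fun t ht z => by
  refine (h.norm_C t ht z).trans ?_
  gcongr
  exact le_envelope h.M_pos h.c_pos z

theorem norm_kernel_le (h : CauchyPair mR mL s c M φ ψ D C) (x y : ℂ) :
    ‖φ x * ψ y / (x - y)‖ ≤ envelope M c x * envelope M c y / 2 :=
  norm_cauchy_le_envelope h.M_pos h.c_pos (h.norm_φ x) (h.norm_ψ y) (h.re_φ x) (h.re_ψ y)

theorem norm_kernel_le' (h : CauchyPair mR mL s c M φ ψ D C) (x y : ℂ) :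
    ‖φ x * ψ y / (x - y)‖ ≤ envelope M c x * envelope M c y :=
  (h.norm_kernel_le x y).trans (half_le_self
    (mul_nonneg (envelope_nonneg h.M_pos h.c_pos x) (envelope_nonneg h.M_pos h.c_pos y)))

theorem norm_add_kernel_le (h : CauchyPair mR mL s c M φ ψ D C) (x y : ℂ) :
    ‖φ x * ψ y / (x - y) + D s y * C x s / (y - x)‖ ≤ envelope M c x * envelope M c y := by
  have h1 := h.norm_kernel_le x y
  have h2 := norm_cauchy_le_envelope h.M_pos h.c_pos (h.norm_D_self y) (h.norm_C_self x)
    (h.re_D y) (h.re_C x)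
  refine (norm_add_le _ _).trans ?_
  linarith

theorem measurable_kernel (h : CauchyPair mR mL s c M φ ψ D C) :
    Measurable (Function.uncurry fun x y => φ x * ψ y / (x - y)) :=
  ((h.measurable_φ.comp measurable_fst).mul (h.measurable_ψ.comp measurable_snd)).div
    (measurable_fst.sub measurable_snd)

theorem measurable_add_kernel (h : CauchyPair mR mL s c M φ ψ D C) :
    Measurable (Function.uncurry fun x y =>
      φ x * ψ y / (x - y) + D s y * C x s / (y - x)) :=
  h.measurable_kernel.add
    (((h.measurable_D_self.comp measurable_snd).mul (h.measurable_C_self.comp measurable_fst)).div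
      (measurable_snd.sub measurable_fst))

theorem hasSum_kernel (h : CauchyPair mR mL s c M φ ψ D C) (x y : ℂ) :
    HasSum (fun i => (φ x * cauchyFun i x) * (2 * ψ y * cauchyFun i (-y)))
      (φ x * ψ y / (x - y)) :=
  hasSum_weighted_cauchy (fun z hz => h.c_pos.trans_le (h.re_φ z hz))
    (fun z hz => h.c_pos.trans_le (h.re_ψ z hz)) x y

/-- The two blocks are treated separately. In the second one the right half plane variable is the
column variable, so `C` supplies the functions of x and `D` those of y. -/
theorem exists_traceClass_add (h : CauchyPair mR mL s c M φ ψ D C) :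
    ∃ T : Lp ℂ 2 (mL + mR) →L[ℂ] Lp ℂ 2 (mL + mR), IsIntegralOperator (mL + mR)
      (fun x y => φ x * ψ y / (x - y) + D s y * C x s / (y - x)) T ∧ IsTraceClass T := by
  have hM := h.M_pos
  have hc := h.c_pos
  have iα : Integrable (fun z => envelope M c z ^ 2) (mL + mR) :=
    (integrable_envelope_sq h.integrableL).add_measure (integrable_envelope_sq h.integrableR)
  have univ : ∀ᵐ z ∂(mL + mR), z ∈ (Set.univ : Set ℂ) := .of_forall fun _ => Set.mem_univ _
  obtain ⟨T, hT, hT'⟩ := exists_traceClass_of_hasSum univ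
    (measurable_mul_cauchyFun h.measurable_φ) (measurable_mul_cauchyFun_neg h.measurable_ψ) iα iα
    (fun x _ => sum_norm_mul_cauchyFun_sq_le_envelope' hM hc (h.norm_φ x) (h.re_φ x))
    (fun x _ => sum_norm_two_mul_cauchyFun_sq_le_envelope hM hc (h.norm_ψ x) (h.re_ψ x))
    (k := fun x y => φ x * ψ y / (x - y)) (fun x _ y _ => h.hasSum_kernel x y)
  obtain ⟨U, hU, hU'⟩ := exists_traceClass_of_hasSum univ
    (measurable_mul_cauchyFun_neg h.measurable_C_self)
    (measurable_mul_cauchyFun h.measurable_D_self) iα iα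
    (fun x _ => sum_norm_two_mul_cauchyFun_sq_le_envelope hM hc (h.norm_C_self x) (h.re_C x))
    (fun x _ => sum_norm_mul_cauchyFun_sq_le_envelope' hM hc (h.norm_D_self x) (h.re_D x))
    (k := fun x y => D s y * C x s / (y - x)) (fun x _ y _ =>
      (hasSum_weighted_cauchy (φ := D s) (ψ := fun z => C z s)
        (fun z hz => hc.trans_le (h.re_D z hz))
        (fun z hz => hc.trans_le (h.re_C z hz)) y x).congr_fun fun i => mul_comm _ _)
  exact ⟨T + U, hT.add hU, hT'.add hU'⟩

theorem exists_traceClass_comp [SigmaFinite mR] [SigmaFinite mL]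
    (h : CauchyPair mR mL s c M φ ψ D C) :
    ∃ T : Lp ℂ 2 (volume.restrict (Set.Ici s)) →L[ℂ] Lp ℂ 2 (volume.restrict (Set.Ici s)),
      IsIntegralOperator (volume.restrict (Set.Ici s)) (fun t t' =>
        ∫ x, D t x * ∫ y, φ x * ψ y / (x - y) * C y t' ∂mL ∂mR) T ∧ IsTraceClass T :=
  OddAiry.exists_traceClass_comp (A := fun x y => φ x * ψ y / (x - y))
    (ae_restrict_mem measurableSet_Ici) h.measurable_D h.measurable_C
    (measurable_mul_cauchyFun h.measurable_φ) (measurable_mul_cauchyFun_neg h.measurable_ψ)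
    (integrable_exp_sq h.c_pos s) (integrable_envelope_sq h.integrableR)
    (integrable_envelope_sq h.integrableL) h.norm_D_le_envelope h.norm_C_le_envelope
    (fun x => sum_norm_mul_cauchyFun_sq_le_envelope' h.M_pos h.c_pos (h.norm_φ x) (h.re_φ x))
    (fun x => sum_norm_two_mul_cauchyFun_sq_le_envelope h.M_pos h.c_pos (h.norm_ψ x) (h.re_ψ x))
    h.hasSum_kernel

theorem fredholmConverges_add [SigmaFinite mR] [SigmaFinite mL]
    (h : CauchyPair mR mL s c M φ ψ D C) (z : ℂ) : FredholmConverges (mL + mR)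
      (fun x y => φ x * ψ y / (x - y) + D s y * C x s / (y - x)) z := by
  refine fredholmConverges_of_bound h.measurable_add_kernel (S := Set.univ)
    (.of_forall fun _ => Set.mem_univ _) (envelope_nonneg h.M_pos h.c_pos)
    (envelope_nonneg h.M_pos h.c_pos) ?_ (fun x _ y _ => h.norm_add_kernel_le x y) z
  simp only [← sq]
  exact (integrable_envelope_sq h.integrableL).add_measure (integrable_envelope_sq h.integrableR)

theorem fredholmConverges_comp [SigmaFinite mR] [SigmaFinite mL]
    (h : CauchyPair mR mL s c M φ ψ D C) (z : ℂ) :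
    FredholmConverges (volume.restrict (Set.Ici s)) (fun t t' =>
      ∫ x, D t x * ∫ y, φ x * ψ y / (x - y) * C y t' ∂mL ∂mR) z := by
  have iR := integrable_envelope_sq (M := M) (c := c) h.integrableR
  have iL := integrable_envelope_sq (M := M) (c := c) h.integrableL
  simp only [sq] at iR iL
  refine fredholmConverges_of_bound
    (measurable_uncurry_comp h.measurable_D h.measurable_kernel h.measurable_C)
    (ae_restrict_mem measurableSet_Ici) (fun t => ?_) (fun t => (Real.exp_pos _).le) ?_
    (norm_comp_le (fun t => (Real.exp_pos _).le) (envelope_nonneg h.M_pos h.c_pos)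
      (envelope_nonneg h.M_pos h.c_pos) iR iL h.norm_D_le_envelope h.norm_kernel_le'
      h.norm_C_le_envelope) z
  · exact mul_nonneg (Real.exp_pos _).le (mul_nonneg (integral_nonneg fun x => mul_self_nonneg _)
      (integral_nonneg fun x => mul_self_nonneg _))
  · refine ((integrable_exp_sq h.c_pos s).mul_const ((∫ x, envelope M c x * envelope M c x ∂mR) *
      ∫ y, envelope M c y * envelope M c y ∂mL)).congr (.of_forall fun t => ?_)
    simp only
    ring

theorem fredholmDet_eq [SigmaFinite mR] [SigmaFinite mL]
    (h : CauchyPair mR mL s c M φ ψ D C) (z : ℂ) :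
    fredholmDet (mL + mR) (fun x y => φ x * ψ y / (x - y) + D s y * C x s / (y - x)) z =
      fredholmDet (volume.restrict (Set.Ici s)) (fun t t' =>
        ∫ x, D t x * ∫ y, φ x * ψ y / (x - y) * C y t' ∂mL ∂mR) (z ^ 2) := by
  have iR := integrable_envelope_sq (M := M) (c := c) h.integrableR
  have iL := integrable_envelope_sq (M := M) (c := c) h.integrableL
  have iW := integrable_exp_sq h.c_pos s
  simp only [sq] at iR iL iW
  -- The right half plane separates the two measures and plays the role of `S` in the off-diagonal
  -- lemmas.
  have mS : MeasurableSet {z : ℂ | 0 < z.re} :=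
    measurableSet_lt measurable_const Complex.measurable_re
  have aeR : ∀ᵐ z ∂mR, z ∈ {z : ℂ | 0 < z.re} := by
    filter_upwards [h.aeR] with z hz using h.c_pos.trans_le hz
  have reL : ∀ z : ℂ, c ≤ (-z).re → z ∉ {z : ℂ | 0 < z.re} := fun z hz h' => by
    have h0 : 0 < z.re := h'
    rw [Complex.neg_re] at hz
    linarith [h.c_pos]
  have aeL : ∀ᵐ z ∂mL, z ∉ {z : ℂ | 0 < z.re} := by
    filter_upwards [h.aeL] with z hz using reL z hz
  have zA : ∀ x y : ℂ, ¬(x ∈ {z : ℂ | 0 < z.re} ∧ y ∉ {z : ℂ | 0 < z.re}) →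
      φ x * ψ y / (x - y) = 0 := fun x y hxy => by
    by_contra h0
    exact hxy ⟨h.c_pos.trans_le (h.re_φ x (left_ne_zero_of_mul (div_ne_zero_iff.1 h0).1)),
      reL y (h.re_ψ y (right_ne_zero_of_mul (div_ne_zero_iff.1 h0).1))⟩
  have zB : ∀ x y : ℂ, ¬(x ∉ {z : ℂ | 0 < z.re} ∧ y ∈ {z : ℂ | 0 < z.re}) →
      D s y * C x s / (y - x) = 0 := fun x y hxy => by
    by_contra h0
    exact hxy ⟨reL x (h.re_C x (right_ne_zero_of_mul (div_ne_zero_iff.1 h0).1)),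
      h.c_pos.trans_le (h.re_D y (left_ne_zero_of_mul (div_ne_zero_iff.1 h0).1))⟩
  have conv := h.fredholmConverges_add z
  rw [add_comm] at conv
  rw [add_comm]
  -- Both terms reduce to ∫∫ det A · det B, the right one after `h.laplace` recognizes ∫ C D as the
  -- block B.
  have even : ∀ m, fredholmTerm (mR + mL)
      (fun x y => φ x * ψ y / (x - y) + D s y * C x s / (y - x)) z (2 * m) =
      fredholmTerm (volume.restrict (Set.Ici s)) (fun t t' =>
        ∫ x, D t x * ∫ y, φ x * ψ y / (x - y) * C y t' ∂mL ∂mR) (z ^ 2) m := fun m => by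
    rw [fredholmTerm_offDiag_even mS aeR aeL zA zB _ m (conv.1 _), fredholmTerm,
      integral_minor_comp (ae_restrict_mem measurableSet_Ici) h.measurable_D h.measurable_kernel
        h.measurable_C (fun t => (Real.exp_pos _).le) (envelope_nonneg h.M_pos h.c_pos)
        (envelope_nonneg h.M_pos h.c_pos) iW iR iL h.norm_D_le_envelope h.norm_kernel_le'
        h.norm_C_le_envelope m]
    simp only [← h.laplace]
    have : (m.factorial : ℂ) ≠ 0 := by exact_mod_cast m.factorial_ne_zero
    field_simp
  have hsum := HasSum.even_add_odd
    (f := fredholmTerm (mR + mL) (fun x y => φ x * ψ y / (x - y) + D s y * C x s / (y - x)) z)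
    (by simpa only [even] using (h.fredholmConverges_comp (z ^ 2)).2.hasSum)
    (m' := 0) (by
      simp only [fredholmTerm_offDiag_odd mS aeR aeL zA zB _ _ (conv.1 _)]
      exact hasSum_zero)
  rw [add_zero] at hsum
  exact hsum.tsum_eq

end CauchyPair
end CauchyPair

/-! ### The Airy weights as an instance of `CauchyPair`. -/

section Assembly

variable {n : ℕ} {τ : ℕ → ℝ} {γL γR : ℝ → ℂ}

theorem integrable_airyIntegrand (hn : 1 ≤ n) (hL : IsLeftContour n γL)
    (hR : IsRightContour n γR) (x y : ℝ) : Integrable (fun q : ℝ × ℝ =>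
      airyIntegrand n τ x y (γR q.1) (γL q.2) * deriv γL q.2 * deriv γR q.1) := by
  have cL := hL.1.continuous
  have cR := hR.1.continuous
  obtain ⟨_, _, gL⟩ := hL.1.length_growth
  obtain ⟨_, _, gR⟩ := hR.1.length_growth
  have eL := integrable_comp_mul_norm_deriv cL hL.1.injective (integrable_exp_neg_norm gL)
  have eR := integrable_comp_mul_norm_deriv cR hR.1.injective (integrable_exp_neg_norm gR)
  -- Thresholds x on γR and y on γL make the factors e^{-c(r-s)} equal to 1. The denominator is at
  -- least c + c'.
  obtain ⟨M, c, hM, hc, reR, -, bR₀, -, bR, -⟩ := exists_weight_bounds hn τ hL hR x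
  obtain ⟨M', c', hM', hc', -, reL, -, bL₀, -, bL⟩ := exists_weight_bounds hn τ hL hR y
  have hp := (continuous_oddPoly n τ).measurable
  have dL := measurable_deriv γL
  have dR := measurable_deriv γR
  refine ((eR.mul_prod eL).const_mul (M ^ 2 * M' ^ 2 / (c + c'))).mono'
    (Measurable.aestronglyMeasurable ?_) (.of_forall fun q => ?_)
  · have mL := cL.measurable
    have mR := cR.measurable
    unfold airyIntegrand
    fun_prop
  · have he : Complex.exp ((-1) ^ (n + 1) * (oddPoly n τ (γR q.1) - oddPoly n τ (γL q.2))
        - x * γR q.1 + y * γL q.2) =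
        (weightR n τ γR x (γR q.1) * weightR n τ γR 0 (γR q.1)) *
        (weightL n τ γL 0 (γL q.2) * weightL n τ γL y (γL q.2)) := by
      simp only [weightR, weightL, curveInd_apply, mul_one]
      rw [← Complex.exp_add, ← Complex.exp_add, ← Complex.exp_add, neg_one_pow_succ_eq]
      congr 1
      push_cast
      ring
    have h1 := bR x le_rfl (γR q.1)
    have h2 := bL y le_rfl (γL q.2)
    rw [sub_self, mul_zero, neg_zero, Real.exp_zero, mul_one] at h1 h2
    have h3 := bR₀ (γR q.1)
    have h4 := bL₀ (γL q.2)
    have h5 : c + c' ≤ ‖γL q.2 - γR q.1‖ := by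
      rw [norm_sub_rev]
      refine le_trans ?_ (Complex.re_le_norm _)
      have e1 := reR _ (Set.mem_range_self q.1)
      have e2 := reL _ (Set.mem_range_self q.2)
      rw [Complex.neg_re] at e2
      rw [Complex.sub_re]
      linarith
    have e1 : ∀ z : ℂ, Real.exp (-‖z‖) ≤ 1 := fun z => by simp
    rw [norm_mul, norm_mul, airyIntegrand, he, norm_div, norm_mul, norm_mul, norm_mul]
    calc _ ≤ ((M * Real.exp (-‖γR q.1‖)) * (M * 1) * ((M' * 1) * (M' * Real.exp (-‖γL q.2‖)))) /
          (c + c') * ‖deriv γL q.2‖ * ‖deriv γR q.1‖ := by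
          gcongr
          · exact h3.trans (by gcongr; exact e1 _)
          · exact h4.trans (by gcongr; exact e1 _)
      _ = _ := by ring

theorem norm_const_le_one : ‖(1 / (2 * Real.pi * Complex.I) : ℂ)‖ ≤ 1 := by
  rw [norm_div, norm_mul, norm_mul, Complex.norm_I, Complex.norm_real, Complex.norm_ofNat, norm_one,
    Real.norm_of_nonneg Real.pi_pos.le]
  refine div_le_one_of_le₀ ?_ (by positivity)
  linarith [Real.pi_gt_three]

theorem exists_cauchyPair (hn : 1 ≤ n) (τ : ℕ → ℝ) (hL : IsLeftContour n γL)
    (hR : IsRightContour n γR) (s : ℝ) : ∃ c M, CauchyPair (arcLength γR) (arcLength γL) s c M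
      (fun z => 1 / (2 * Real.pi * Complex.I) * weightR n τ γR 0 z)
      (fun z => weightL n τ γL 0 z * unitTangent γL z)
      (fun t z => weightR n τ γR t z * unitTangent γR z)
      (fun z t => -(1 / (2 * Real.pi * Complex.I)) * weightL n τ γL t z) := by
  have cL := hL.1.continuous
  have cR := hR.1.continuous
  have iL := hL.1.injective
  have iR := hR.1.injective
  obtain ⟨_, _, gL⟩ := hL.1.length_growth
  obtain ⟨_, _, gR⟩ := hR.1.length_growth
  have mwR := measurable_weightR (n := n) (τ := τ) cR iR
  have mwL := measurable_weightL (n := n) (τ := τ) cL iL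
  have muL := measurable_unitTangent cL iL
  have muR := measurable_unitTangent cR iR
  obtain ⟨M, c, hM, hc, reR, reL, bR₀, bL₀, bR, bL⟩ := exists_weight_bounds hn τ hL hR s
  refine ⟨c, M, {
    c_pos := hc
    M_pos := hM
    integrableR := integrable_exp_neg_norm gR
    integrableL := integrable_exp_neg_norm gL
    aeR := by filter_upwards [ae_arcLength_mem_range cR iR] with z hz using reR z hz
    aeL := by filter_upwards [ae_arcLength_mem_range cL iL] with z hz using reL z hz
    measurable_φ := (mwR.comp measurable_prodMk_left).const_mul _
    measurable_ψ := (mwL.comp measurable_prodMk_left).mul muL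
    measurable_D := mwR.mul (muR.comp measurable_snd)
    measurable_C := (mwL.comp measurable_swap).const_mul _
    re_φ := fun z hz => reR z (mem_range_of_weightR_ne_zero (right_ne_zero_of_mul hz))
    re_ψ := fun z hz => reL z (mem_range_of_weightL_ne_zero (left_ne_zero_of_mul hz))
    re_D := fun z hz => reR z (mem_range_of_weightR_ne_zero (left_ne_zero_of_mul hz))
    re_C := fun z hz => reL z (mem_range_of_weightL_ne_zero (right_ne_zero_of_mul hz))
    norm_φ := fun z => ?_
    norm_ψ := fun z => ?_
    norm_D := fun t ht z => ?_
    norm_C := fun t ht z => ?_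
    laplace := fun x y => kernelLR_eq hL hR s x y }⟩
  · rw [norm_mul]
    exact (mul_le_of_le_one_left (norm_nonneg _) norm_const_le_one).trans (bR₀ z)
  · rw [norm_mul]
    exact (mul_le_of_le_one_right (norm_nonneg _) (norm_unitTangent_le z)).trans (bL₀ z)
  · rw [norm_mul]
    exact (mul_le_of_le_one_right (norm_nonneg _) (norm_unitTangent_le z)).trans (bR t ht z)
  · rw [norm_mul, norm_neg]
    exact (mul_le_of_le_one_left (norm_nonneg _) norm_const_le_one).trans (bL t ht z)

end Assembly

end OddAiry

end


theorem proposition2p1 (n : ℕ) (hn : 1 ≤ n) (τ : ℕ → ℝ) (γL γR : ℝ → ℂ)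
    (hL : IsLeftContour n γL) (hR : IsRightContour n γR)
    (s ϱ : ℝ) (hϱ0 : 0 < ϱ) (hϱ1 : ϱ ≤ 1) :
    -- the double integral that defines `K(x, y)` converges absolutely
    (∀ x y : ℝ, Integrable (fun q : ℝ × ℝ =>
      airyIntegrand n τ x y (γR q.1) (γL q.2) * deriv γL q.2 * deriv γR q.1)) ∧
    -- `L_s` is of integrable type
    (∀ z : ℂ, vecF n τ γL γR s z ⬝ᵥ vecG n τ γL γR s z = 0) ∧
    -- both integral operators are well defined and trace class
    (∃ T : Lp ℂ 2 (arcLength γL + arcLength γR) →L[ℂ] Lp ℂ 2 (arcLength γL + arcLength γR),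
      IsIntegralOperator (arcLength γL + arcLength γR) (kernelLArc n τ γL γR s) T ∧
        IsTraceClass T) ∧
    (∃ T : Lp ℂ 2 (volume.restrict (Set.Ici s)) →L[ℂ] Lp ℂ 2 (volume.restrict (Set.Ici s)),
      IsIntegralOperator (volume.restrict (Set.Ici s)) (airyKernel n τ γL γR) T ∧
        IsTraceClass T) ∧
    -- both Fredholm determinants are well defined, and they agree
    FredholmConverges (arcLength γL + arcLength γR) (kernelLArc n τ γL γR s) (Real.sqrt ϱ : ℂ) ∧
    FredholmConverges (volume.restrict (Set.Ici s)) (airyKernel n τ γL γR) (ϱ : ℂ) ∧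
    fredholmDet (arcLength γL + arcLength γR) (kernelLArc n τ γL γR s) (Real.sqrt ϱ : ℂ) =
      fredholmDet (volume.restrict (Set.Ici s)) (airyKernel n τ γL γR) (ϱ : ℂ) := by
  obtain ⟨_, _, gL⟩ := hL.1.length_growth
  obtain ⟨_, _, gR⟩ := hR.1.length_growth
  have := sigmaFinite_of_growth gL
  have := sigmaFinite_of_growth gR
  obtain ⟨c, M, h⟩ := exists_cauchyPair hn τ hL hR s
  have hK := airyKernel_eq (n := n) (τ := τ) hL.1.continuous hL.1.injective hR.1.continuous
    hR.1.injective
  have hsq : (Real.sqrt ϱ : ℂ) ^ 2 = ϱ := by rw [← Complex.ofReal_pow, Real.sq_sqrt hϱ0.le]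
  refine ⟨integrable_airyIntegrand hn hL hR, vecF_dotProduct_vecG hL hR s, ?_, ?_, ?_, ?_, ?_⟩
  · rw [kernelLArc_eq hL hR s]
    exact h.exists_traceClass_add
  · rw [hK]
    exact h.exists_traceClass_comp
  · rw [kernelLArc_eq hL hR s]
    exact h.fredholmConverges_add _
  · rw [hK]
    exact h.fredholmConverges_comp _
  · rw [kernelLArc_eq hL hR s, hK, ← hsq]
    exact h.fredholmDet_eq _
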